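/- **Objects.** Write $[m]=\{1,\dots,m\}$. A *matching* on $[m]$ is a fixed-point free involution of $[m]$. For a finite set $I$ of integers, $\lambda_I$ is the increasing bijection from $[|I|]$ to $I$. A *well-labelled path* of size $n\ge 1$ is a pair $(\mathbf p,\sigma)$ of a word $\mathbf p=p_1\cdots p_{n-1}$ on $\{-1,0,1\}$ and a permutation $\sigma=\sigma_1\cdots\sigma_n$ of $[n]$ such that $p_i=-1$ implies $\sigma_i<\sigma_{i+1}$ and $p_i=1$ implies $\sigma_i>\sigma_{i+1}$. It is *Motzkin* if $\sum_{i\le j}p_i\ge0$ for $1\le j\le n-2$ and $\sum_{i\le n-1}p_i=-1$; it is *positive* if $\sum_{i\le j}p_i\ge0$ for $1\le j\le n-1$. A *labelled binary tree* of size $n$ is a rooted tree with $n$ leaves, labelled bijectively by $[n]$, in which every internal vertex has exactly two children, unordered. A *marked* labelled binary tree is a labelled binary tree with one distinguished (internal or external) vertex. If $\lambda$ is a bijection between sets of labels, $\lambda(\tau)$ is the tree $\tau$ with each leaf label $i$ replaced by $\lambda(i)$; marks are kept. For a well-labelled path $(\mathbf p,\sigma)$ of size $n$ and $1\le k\le n$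 let $I'_k=\{\sigma_1,\dots,\sigma_k\}$ and $I''_k=\{\sigma_{k+1},\dots,\sigma_n\}$. Let $P'_k$ be the pair of the word $p'_i=-p_{k-i}$ ($1\le i\le k-1$) and the permutation $\sigma'_i=\lambda_{I'_k}^{-1}(\sigma_{k+1-i})$ ($1\le i\le k$). For $k<n$ let $P''_k$ be the pair of the word $p''_i=p_{k+i}$ ($1\le i\le n-k-1$) and the permutation $\sigma''_i=\lambda_{I''_k}^{-1}(\sigma_{k+i})$ ($1\le i\le n-k$). **The map $\Phi$** is defined recursively on well-labelled Motzkin paths $P=(\mathbf p,\sigma)$ of size $n\ge2$. If $n=2$, $\Phi(P)$ is the only labelled binary tree of size $2$. If $n>2$ and $p_1=0$, $\Phi(P)$ is the tree whose root has as subtrees the leaf labelled $\sigma_1$ and $\lambda_{I''_1}(\Phi(P''_1))$. If $n>2$ and $p_1=1$, let $k\ge 1$ be least with $\sum_{i\le k}p_i=0$; then $\Phi(P)$ is the tree whose root has as subtrees $\lambda_{I'_k}(\Phi(P'_k))$ and $\lambda_{I''_k}(\Phi(P''_k))$. **The map $\Phi'$** is defined recursively on well-labelled positive paths $P=(\mathbf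 p,\sigma)$ of size $n\ge1$. If $n=1$, $\Phi'(P)$ is the only marked labelled binary tree of size $1$. If $n>1$ and $p_1=0$, $\Phi'(P)$ has a non-marked root, whose subtrees are the non-marked leaf labelled $\sigma_1$ and the marked tree $\lambda_{I''_1}(\Phi'(P''_1))$. If $n>1$ and $p_1=1$, let $k\le n$ be greatest such that $\sum_{i\le j-1}p_i\ge1$ for $2\le j\le k-1$ and $\sum_{i\le k-1}p_i=1$. If $k=n$, $\Phi'(P)$ is $\Phi(P'_n)$ marked at its root. If $k<n$, $\Phi'(P)$ has a non-marked root, whose subtrees are the non-marked tree $\lambda_{I'_k}(\Phi(P'_k))$ and the marked tree $\lambda_{I''_k}(\Phi'(P''_k))$. **The map $\Psi$.** Let $\tau$ be a labelled binary tree of size $n\ge1$. Label the internal non-root vertices by the following procedure: as long as some non-root vertex is unlabelled, among the unlabelled non-root vertices whose two children are both labelled take the one that has the child with least label, and give it the least label in $[2n-2]\setminus[n]$ not yet attributed. Then $\pi=\Psi(\tau)$ is the matching on $[2n-2]$ with $\pi(i)=j$ whenever $i,j$ are the labels of two siblings. **The map $\Psi'$.** Let $\tau'$ be a marked labelled binary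 tree of size $n\ge1$, $\tau$ the underlying unmarked tree, $v$ the marked vertex, and $\pi=\Psi(\tau)$. If $v$ is the root, $\pi'=\Psi'(\tau')$ is $\pi$ together with $\pi'(2n-1)=2n$ (and $\pi'(2n)=2n-1$). Otherwise, if $k$ is the label of $v$ and $l$ the label of its sibling, $\pi'$ is the involution of $[2n]$ with $\pi'(k)=2n$, $\pi'(l)=2n-1$ and $\pi'(i)=\pi(i)$ for $i\in[2n-2]\setminus\{k,l\}$. **Theorem.** (a) For every $n\ge2$, $\Phi$ maps well-labelled Motzkin paths of size $n$ to labelled binary trees of size $n$, $\Psi$ maps the latter to matchings on $[2n-2]$, and the composition $\Psi\circ\Phi$ is a bijection between well-labelled Motzkin paths of size $n$ and matchings on $[2n-2]$. (b) For every $n\ge1$, $\Phi'$ maps well-labelled positive paths of size $n$ to marked labelled binary trees of size $n$, $\Psi'$ maps the latter to matchings on $[2n]$, and the composition $\Psi'\circ\Phi'$ is a bijection between well-labelled positive paths of size $n$ and matchings on $[2n]$. (c) Consequently, for every $n\ge1$, the number of well-labelled Motzkin paths of size $n+1$ and the number of well-labelled positive paths of size $n$ are both equal to $(2n-1)!!=(2n-1)(2n-3)\cdots3\cdot1$.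 -/

import Mathlib

namespace WellLabelled

/-! ### Relabelling -/

/-- `λ_I`, the increasing bijection from `{1, …, #I}` to the finite set `I`. -/
noncomputable def lam (I : Finset ℕ) (i : ℕ) : ℕ := Nat.nth (fun x => x ∈ I) (i - 1)

/-- `λ_I⁻¹`, the increasing bijection from the finite set `I` to `{1, …, #I}`:
one plus the number of elements of `I` below `x`. -/
def lamInv (I : Finset ℕ) (x : ℕ) : ℕ := Nat.count (fun y => y ∈ I) x + 1

/-- The word `λ_I⁻¹(w₁) λ_I⁻¹(w₂) …`, where `I` is the set of letters of `w`. -/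
def standardize (w : List ℕ) : List ℕ := w.map (lamInv w.toFinset)

/-! ### Well-labelled paths -/

/-- A pair `(p, σ)` of a word of steps and a word of labels. -/
@[ext]
structure LPath where
  steps : List ℤ
  labels : List ℕ

/-- The size of a path: its number of points, that is, of labels. -/
def LPath.size (P : LPath) : ℕ := P.labels.length

/-- `p₁ + ⋯ + p_j`. -/
def LPath.height (P : LPath) (j : ℕ) : ℤ := (P.steps.take j).sum

/-- `(p, σ)` is a well-labelled path of size `n`: `p` is a word of length `n - 1` on `{-1, 0, 1}`,
`σ` is a permutation of `{1, …, n}` (in one-line notation), and `σ` increases along each step `-1`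
and decreases along each step `1`. There is none of size `0`.
Lists are indexed from `0`, so step number `i` joins the points number `i` and `i + 1`. -/
structure IsWellLabelled (n : ℕ) (P : LPath) : Prop where
  length_steps : P.steps.length + 1 = n
  mem_steps : ∀ s ∈ P.steps, s = -1 ∨ s = 0 ∨ s = 1
  perm_labels : P.labels.Perm (List.range' 1 n)
  lt_of_down : ∀ i < P.steps.length, P.steps.getD i 0 = -1 →
    P.labels.getD i 0 < P.labels.getD (i + 1) 0
  gt_of_up : ∀ i < P.steps.length, P.steps.getD i 0 = 1 →
    P.labels.getD (i + 1) 0 < P.labels.getD i 0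

/-- The set of well-labelled Motzkin paths of size `n`: `p₁ + ⋯ + p_j ≥ 0` for `j = 1, …, n - 2`
and `p₁ + ⋯ + p_{n-1} = -1`. -/
def motzkinPaths (n : ℕ) : Set LPath :=
  {P | IsWellLabelled n P ∧ (∀ j, 1 ≤ j → j + 2 ≤ n → 0 ≤ P.height j) ∧ P.height (n - 1) = -1}

/-- The set of well-labelled positive paths of size `n`: `p₁ + ⋯ + p_j ≥ 0` for
`j = 1, …, n - 1`. -/
def positivePaths (n : ℕ) : Set LPath :=
  {P | IsWellLabelled n P ∧ ∀ j, 1 ≤ j → j + 1 ≤ n → 0 ≤ P.height j}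

/-- The path on the first `k` points, read backward and with standardized labels:
`p'ᵢ = -p_{k-i}` and `σ'ᵢ = λ⁻¹(σ_{k+1-i})`. -/
def LPath.revPrefix (P : LPath) (k : ℕ) : LPath where
  steps := (P.steps.take (k - 1)).reverse.map (fun s => -s)
  labels := standardize (P.labels.take k).reverse

/-- The path on the points after the `k`-th one, with standardized labels:
`p''ᵢ = p_{k+i}` and `σ''ᵢ = λ⁻¹(σ_{k+i})`. -/
def LPath.suffix (P : LPath) (k : ℕ) : LPath where
  steps := P.steps.drop k
  labels := standardize (P.labels.drop k)

/-- The set of labels of the first `k` points. -/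
def LPath.prefixLabels (P : LPath) (k : ℕ) : Finset ℕ := (P.labels.take k).toFinset

/-- The set of labels of the points after the `k`-th one. -/
def LPath.suffixLabels (P : LPath) (k : ℕ) : Finset ℕ := (P.labels.drop k).toFinset

theorem LPath.size_suffix (P : LPath) (k : ℕ) : (P.suffix k).size = P.size - k := by
  simp [LPath.suffix, LPath.size, standardize]

theorem LPath.size_revPrefix (P : LPath) (k : ℕ) : (P.revPrefix k).size = min k P.size := by
  simp [LPath.revPrefix, LPath.size, standardize]

/-! ### Labelled binary trees -/

/-- Rooted binary trees with labelled leaves. Since the two children of a vertex are meant to be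
unordered, only the trees satisfying `BTree.Normal` below are used: at every internal vertex the
child written first is the one whose subtree contains the smaller least leaf label. Every unordered
binary tree with distinct leaf labels is written in exactly one way like this. -/
inductive BTree where
  | leaf (a : ℕ) : BTree
  | node (l r : BTree) : BTree
  deriving DecidableEq

namespace BTree

/-- The list of leaf labels. -/
def leaves : BTree → List ℕ
  | leaf a => [a]
  | node l r => l.leaves ++ r.leaves

/-- The least leaf label. -/
def minLeaf : BTree → ℕ
  | leaf a => a
  | node l r => min l.minLeaf r.minLeaf

/-- The children of each internal vertex are written in increasing order of least leaf label. -/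
def Normal : BTree → Prop
  | leaf _ => True
  | node l r => l.minLeaf < r.minLeaf ∧ l.Normal ∧ r.Normal

/-- The tree made of a root and the two (unordered) subtrees `t` and `u`. -/
def join (t u : BTree) : BTree := if t.minLeaf < u.minLeaf then node t u else node u t

/-- The tree obtained by replacing each leaf label `a` by `f a`. -/
def relabel (f : ℕ → ℕ) : BTree → BTree
  | leaf a => leaf (f a)
  | node l r => join (l.relabel f) (r.relabel f)

/-- The vertices of a tree, each one given as the subtree hanging from it (the leaf labels being
distinct, different vertices give different subtrees). The root is the tree itself. -/
def vertices : BTree → Finset BTree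
  | leaf a => {leaf a}
  | node l r => insert (node l r) (l.vertices ∪ r.vertices)

end BTree

open BTree

/-- The set of labelled binary trees of size `n`: their `n` leaves have distinct labels `1, …, n`. -/
def labelledTrees (n : ℕ) : Set BTree :=
  {t | t.leaves.Perm (List.range' 1 n) ∧ t.Normal}

/-- The set of marked labelled binary trees of size `n`: a tree together with one of its
vertices. -/
def markedTrees (n : ℕ) : Set (BTree × BTree) :=
  {m | m.1 ∈ labelledTrees n ∧ m.2 ∈ m.1.vertices}

/-! ### The maps from paths to trees -/

/-- The map `Φ`. The value on size at most two is the tree of size two, which is the image of the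
only well-labelled Motzkin path of size two. Otherwise one removes the first point if the first
step is `0`; if not, one cuts after the point number `k`, where `k` is least with
`p₁ + ⋯ + p_k = 0`. (The last value is only there to make the map total.) -/
noncomputable def Phi (P : LPath) : BTree :=
  if P.size ≤ 2 then node (leaf 1) (leaf 2)
  else if P.steps.head? = some 0 then
    join (leaf (P.labels.headD 0))
      ((Phi (P.suffix 1)).relabel (lam (P.suffixLabels 1)))
  else if hk : ∃ k, k < P.size ∧ 1 ≤ k ∧ P.height k = 0 then
    join ((Phi (P.revPrefix (Nat.find hk))).relabel (lam (P.prefixLabels (Nat.find hk))))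
      ((Phi (P.suffix (Nat.find hk))).relabel (lam (P.suffixLabels (Nat.find hk))))
  else node (leaf 1) (leaf 2)
  termination_by P.size
  decreasing_by
  · rw [LPath.size_suffix]; omega
  · have h := Nat.find_spec hk
    rw [LPath.size_revPrefix]; omega
  · have h := Nat.find_spec hk
    rw [LPath.size_suffix]; omega

/-- `p₁ + ⋯ + p_{j-1} ≥ 1` for `j = 2, …, k - 1` and `p₁ + ⋯ + p_{k-1} = 1`. -/
def LPath.IsCut (P : LPath) (k : ℕ) : Prop :=
  (∀ j ∈ Finset.Icc 2 (k - 1), 1 ≤ P.height (j - 1)) ∧ P.height (k - 1) = 1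

instance (P : LPath) : DecidablePred P.IsCut := fun k => by
  unfold LPath.IsCut; infer_instance

/-- The greatest `k ≤ n` satisfying `P.IsCut k`, where `n` is the size of the path (and `0` if
there is no such `k`). -/
def LPath.lastCut (P : LPath) : ℕ := Nat.findGreatest P.IsCut P.size

/-- The map `Φ'`. The path of size one goes to the marked tree of size one. Otherwise one removes
the first point if the first step is `0`; if not, one cuts after the point number
`k = P.lastCut`, the case `k = n` being the last one below. -/
noncomputable def PhiMarked (P : LPath) : BTree × BTree :=
  if P.size ≤ 1 then (leaf 1, leaf 1)
  else if P.steps.head? = some 0 then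
    let m := PhiMarked (P.suffix 1)
    let f := lam (P.suffixLabels 1)
    (join (leaf (P.labels.headD 0)) (m.1.relabel f), m.2.relabel f)
  else if 0 < P.lastCut ∧ P.lastCut < P.size then
    let k := P.lastCut
    let m := PhiMarked (P.suffix k)
    let f := lam (P.suffixLabels k)
    (join ((Phi (P.revPrefix k)).relabel (lam (P.prefixLabels k))) (m.1.relabel f),
      m.2.relabel f)
  else
    let t := Phi (P.revPrefix P.size)
    (t, t)
  termination_by P.size
  decreasing_by
  · rw [LPath.size_suffix]; omega
  · rw [LPath.size_suffix]; omega

/-! ### The maps from trees to matchings -/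

/-- The set of matchings (fixed-point free involutions) on `{1, …, m}`. Such an involution is
extended to `ℕ` by the identity, so that it is an involution of `ℕ` whose set of non-fixed points
is exactly `{1, …, m}`. -/
def matchings (m : ℕ) : Set (ℕ → ℕ) :=
  {π | Function.Involutive π ∧ ∀ i, π i ≠ i ↔ i ∈ Finset.Icc 1 m}

/-- The least label of a child of the vertex `v`, for a partial labelling `lab` defined on the
children of `v`. -/
def childMin (lab : BTree → Option ℕ) : BTree → ℕ
  | leaf _ => 0
  | node l r => min ((lab l).getD 0) ((lab r).getD 0)

/-- Both children of the vertex exist and are labelled. -/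
def ChildrenLabelled (lab : BTree → Option ℕ) : BTree → Prop
  | leaf _ => False
  | node l r => (lab l).isSome ∧ (lab r).isSome

/-- `v` is the vertex of `t` that the procedure labels next: it is an unlabelled non-root vertex
with both children labelled, and among all such vertices it has the child with least label. -/
def IsNext (t : BTree) (lab : BTree → Option ℕ) (v : BTree) : Prop :=
  (v ∈ t.vertices ∧ v ≠ t ∧ lab v = none ∧ ChildrenLabelled lab v) ∧
    ∀ w ∈ t.vertices, w ≠ t → lab w = none → ChildrenLabelled lab w →
      childMin lab v ≤ childMin lab w

open Classical in
/-- One step of the labelling procedure: the next vertex receives the label `c`. -/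
noncomputable def labelStep (t : BTree) (lab : BTree → Option ℕ) (c : ℕ) : BTree → Option ℕ :=
  if h : ∃ v, IsNext t lab v then Function.update lab h.choose (some c) else lab

/-- The initial partial labelling: the leaves carry their labels. -/
def leafLabel : BTree → Option ℕ
  | leaf a => some a
  | node _ _ => none

/-- The labelling of the non-root vertices of a tree with `n` leaves: the labels
`n + 1, …, 2 n - 2` are attributed one after the other to the internal non-root vertices. -/
noncomputable def vertexLabel (n : ℕ) (t : BTree) : BTree → Option ℕ :=
  (List.range' (n + 1) (n - 2)).foldl (labelStep t) leafLabel

/-- `i` and `j` are the labels of two siblings of `t`. -/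
def AreSiblingLabels (n : ℕ) (t : BTree) (i j : ℕ) : Prop :=
  ∃ l r, node l r ∈ t.vertices ∧
    ((vertexLabel n t l = some i ∧ vertexLabel n t r = some j) ∨
      (vertexLabel n t l = some j ∧ vertexLabel n t r = some i))

open Classical in
/-- The map `Ψ` on trees with `n` leaves: `π(i) = j` whenever `i`, `j` are the labels of
siblings. -/
noncomputable def Psi (n : ℕ) (t : BTree) (i : ℕ) : ℕ :=
  if h : ∃ j, AreSiblingLabels n t i j then h.choose else i

/-- The map `Ψ'` on marked trees `(t, v)` with `n` leaves. If `v` is the root, the pair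
`{2n - 1, 2n}` is added to the matching `π = Ψ(t)`. Otherwise let `k` be the label of `v` and
`l = π(k)` the label of its sibling: the pair `{k, l}` of `π` is replaced by `{k, 2n}` and
`{l, 2n - 1}`. -/
noncomputable def PsiMarked (n : ℕ) (m : BTree × BTree) : ℕ → ℕ :=
  let π := Psi n m.1
  if m.2 = m.1 then
    Function.update (Function.update π (2 * n - 1) (2 * n)) (2 * n) (2 * n - 1)
  else
    let k := (vertexLabel n m.1 m.2).getD 0
    let l := π k
    Function.update (Function.update (Function.update (Function.update π
      k (2 * n)) (2 * n) k) l (2 * n - 1)) (2 * n - 1) l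

end WellLabelled

/-! The maps `Phi` and `PhiMarked` are inverted by an explicit coding of trees by paths. The path
`treePath` of a leaf is one point; the path of a larger tree is the `merge` of the paths of its two
subtrees. A Motzkin path read backward stays at height at least `1` after its first point and ends
at `1`. Hence, followed by a step `-1` and another Motzkin path, it gives a Motzkin path whose first
return to `0` is at the junction. The order of the two labels at the junction tells which subtree
comes first; a one-point part next to a longer one is put first and followed by a step `0`. The
first return can be read off the path, so `treePath` is injective (`treePath_inj`), and by induction
`Phi P` is a tree with path `P` (`codes_Phi`). Standardizing labels is harmless because increasing
relabellings commute with the coding.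

For a marked tree, `markedPath` is the reversed path of the tree if the root is marked. Otherwise it
is the reversed path of the unmarked subtree of the root, then one step, then the path of the marked
subtree. The cut is now the longest possible prefix of its kind (`PosCut.not_lt`), which again gives
injectivity (`markedPath_inj`) and `codesMarked_PhiMarked`.

For `Psi`, giving the root the label `2n - 1` makes the labelling a bijection from the vertices to
`{1, …, 2n - 1}`, increasing from child to parent and greedy (`GoodLabel`). From the matching the
tree is rebuilt label by label: the vertex labelled `c` is the parent of the available pair of
siblings with least label (`injOn_Psi`). Surjectivity is obtained by counting. Inserting the leaf `n
+ 1` as a sibling of one of the `2n - 1` vertices gives enough trees (`ncard_matchings_le`), since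
the matchings on two more points are parametrized by `2n - 1` choices and a smaller matching
(`bijOn_addPair`). Finally `PsiMarked` is `addPair` applied to the label of the marked vertex and
the matching of the tree (`PsiMarked_eq`), hence bijective. -/

namespace WellLabelled

/-! ### Paths with arbitrary labels: reversal, concatenation, relabelling. -/

/-- A step `s` is allowed between two consecutive labels `a` and `b`. -/
def StepOK (s : ℤ) (a b : ℕ) : Prop := (s = -1 ∧ a < b) ∨ s = 0 ∨ (s = 1 ∧ b < a)

theorem StepOK.neg {s : ℤ} {a b : ℕ} (h : StepOK s a b) : StepOK (-s) b a := by
  unfold StepOK at *; omega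

namespace LPath

/-- The path read backward. -/
def rev (P : LPath) : LPath := ⟨P.steps.reverse.map (fun s => -s), P.labels.reverse⟩

/-- The concatenation of two paths, with a step `x` from the last point of the first one to the
first point of the second one. -/
def cat (P : LPath) (x : ℤ) (Q : LPath) : LPath := ⟨P.steps ++ x :: Q.steps, P.labels ++ Q.labels⟩

/-- The path with relabelled points. -/
def map (f : ℕ → ℕ) (P : LPath) : LPath := ⟨P.steps, P.labels.map f⟩

/-- The label of the first point. -/
def first (P : LPath) : ℕ := P.labels.headD 0

/-- The length and the order conditions of a well-labelled path, for arbitrary labels. -/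
structure Compat (P : LPath) : Prop where
  length_labels : P.labels.length = P.steps.length + 1
  step : ∀ i < P.steps.length,
    StepOK (P.steps.getD i 0) (P.labels.getD i 0) (P.labels.getD (i + 1) 0)

@[simp] theorem rev_rev (P : LPath) : P.rev.rev = P := by
  ext1 <;> simp [rev]

@[simp] theorem length_steps_rev (P : LPath) : P.rev.steps.length = P.steps.length := by
  simp [rev]

@[simp] theorem labels_rev (P : LPath) : P.rev.labels = P.labels.reverse := rfl

@[simp] theorem labels_cat (P : LPath) (x : ℤ) (Q : LPath) :
    (P.cat x Q).labels = P.labels ++ Q.labels := rfl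

@[simp] theorem steps_cat (P : LPath) (x : ℤ) (Q : LPath) :
    (P.cat x Q).steps = P.steps ++ x :: Q.steps := rfl

@[simp] theorem labels_map (f : ℕ → ℕ) (P : LPath) : (P.map f).labels = P.labels.map f := rfl

@[simp] theorem steps_map (f : ℕ → ℕ) (P : LPath) : (P.map f).steps = P.steps := rfl

theorem map_rev (f : ℕ → ℕ) (P : LPath) : (P.map f).rev = P.rev.map f := by
  ext1 <;> simp [rev, map]

theorem map_cat (f : ℕ → ℕ) (P : LPath) (x : ℤ) (Q : LPath) :
    (P.map f).cat x (Q.map f) = (P.cat x Q).map f := by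
  ext1 <;> simp [cat, map]

theorem Compat.labels_ne_nil {P : LPath} (h : P.Compat) : P.labels ≠ [] := by
  have := h.length_labels
  intro h; simp [h] at this

theorem Compat.first_mem {P : LPath} (h : P.Compat) : P.first ∈ P.labels := by
  have := h.labels_ne_nil
  unfold first
  cases hl : P.labels <;> simp_all

theorem Compat.first_map {P : LPath} (h : P.Compat) (f : ℕ → ℕ) : (P.map f).first = f P.first := by
  have := h.labels_ne_nil
  unfold first
  cases hl : P.labels <;> simp_all

theorem Compat.rev_eq_self {P : LPath} (h : P.Compat) (h0 : P.steps = []) : P.rev = P := by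
  have := h.length_labels
  rw [h0] at this
  obtain ⟨a, ha⟩ := List.length_eq_one_iff.1 this
  ext1 <;> simp [rev, h0, ha]

theorem Compat.rev {P : LPath} (h : P.Compat) : P.rev.Compat := by
  have hl := h.length_labels
  refine ⟨by simpa [LPath.rev] using hl, fun i hi => ?_⟩
  simp only [length_steps_rev] at hi
  have := (h.step (P.steps.length - 1 - i) (by omega)).neg
  simp only [LPath.rev, List.getD_eq_getElem?_getD] at *
  rw [List.getElem?_map, List.getElem?_reverse (by omega), List.getElem?_reverse (by omega),
    List.getElem?_reverse (by omega)]
  rw [show P.labels.length - 1 - i = P.steps.length - 1 - i + 1 by omega,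
    show P.labels.length - 1 - (i + 1) = P.steps.length - 1 - i by omega]
  rw [List.getElem?_eq_getElem (show P.steps.length - 1 - i < P.steps.length by omega)] at *
  simpa using this

/-- The last label of `P` is written `P.rev.first`. Only the lengths are assumed, so the equivalence
serves both to build paths and to cut them. -/
theorem Compat.cat_iff {P Q : LPath} {x : ℤ} (hP : P.labels.length = P.steps.length + 1)
    (hQ : Q.labels.length = Q.steps.length + 1) :
    (P.cat x Q).Compat ↔ P.Compat ∧ StepOK x P.rev.first Q.first ∧ Q.Compat := by
  have e1 : P.rev.first = P.labels.getD P.steps.length 0 := by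
    rw [first, labels_rev, List.headD_eq_head?_getD, List.head?_reverse,
      List.getLast?_eq_getElem?, hP]
    simp
  have e2 : Q.first = Q.labels.getD 0 0 := by
    unfold first; cases Q.labels <;> simp
  rw [e1, e2]
  constructor
  · intro h
    refine ⟨⟨hP, fun i hi => ?_⟩, ?_, ⟨hQ, fun i hi => ?_⟩⟩
    · have := h.step i (by simp; omega)
      simp only [steps_cat, labels_cat, List.getD_eq_getElem?_getD] at *
      rw [List.getElem?_append_left (by omega), List.getElem?_append_left (by omega),
        List.getElem?_append_left (by omega)] at this
      exact this
    · have := h.step P.steps.length (by simp)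
      simp only [steps_cat, labels_cat, List.getD_eq_getElem?_getD] at *
      rw [List.getElem?_append_right (by omega), List.getElem?_append_left (by omega),
        List.getElem?_append_right (by omega)] at this
      simpa [hP] using this
    · have := h.step (P.steps.length + 1 + i) (by simp; omega)
      simp only [steps_cat, labels_cat, List.getD_eq_getElem?_getD] at *
      rw [List.getElem?_append_right (by omega), List.getElem?_append_right (by omega),
        List.getElem?_append_right (by omega)] at this
      rw [show P.steps.length + 1 + i - P.steps.length = i + 1 by omega,
        show P.steps.length + 1 + i - P.labels.length = i by omega,
        show P.steps.length + 1 + i + 1 - P.labels.length = i + 1 by omega] at this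
      simpa using this
  · rintro ⟨h1, h2, h3⟩
    refine ⟨by simp; omega, fun i hi => ?_⟩
    simp only [steps_cat, List.length_append, List.length_cons] at hi
    rcases lt_trichotomy i P.steps.length with hi' | rfl | hi'
    · have := h1.step i hi'
      simp only [steps_cat, labels_cat, List.getD_eq_getElem?_getD] at *
      rw [List.getElem?_append_left (by omega), List.getElem?_append_left (by omega),
        List.getElem?_append_left (by omega)]
      exact this
    · simp only [steps_cat, labels_cat, List.getD_eq_getElem?_getD] at *
      rw [List.getElem?_append_right (by omega), List.getElem?_append_left (by omega),
        List.getElem?_append_right (by omega)]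
      simpa [hP] using h2
    · obtain ⟨k, rfl⟩ : ∃ k, i = P.steps.length + 1 + k := ⟨i - P.steps.length - 1, by omega⟩
      have := h3.step k (by omega)
      simp only [steps_cat, labels_cat, List.getD_eq_getElem?_getD] at *
      rw [List.getElem?_append_right (by omega), List.getElem?_append_right (by omega),
        List.getElem?_append_right (by omega)]
      rw [show P.steps.length + 1 + k - P.steps.length = k + 1 by omega,
        show P.steps.length + 1 + k - P.labels.length = k by omega,
        show P.steps.length + 1 + k + 1 - P.labels.length = k + 1 by omega]
      simpa using this

theorem Compat.map {P : LPath} (h : P.Compat) {f : ℕ → ℕ}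
    (hf : StrictMonoOn f {x | x ∈ P.labels}) : (P.map f).Compat := by
  have hl := h.length_labels
  refine ⟨by simpa using hl, fun i hi => ?_⟩
  simp only [steps_map] at hi
  have := h.step i hi
  simp only [labels_map, steps_map, List.getD_eq_getElem?_getD] at *
  rw [List.getElem?_map, List.getElem?_map]
  rw [List.getElem?_eq_getElem (show i < P.labels.length by omega),
    List.getElem?_eq_getElem (show i + 1 < P.labels.length by omega)] at *
  have m1 : P.labels[i]'(by omega) ∈ {x | x ∈ P.labels} := List.getElem_mem _
  have m2 : P.labels[i+1]'(by omega) ∈ {x | x ∈ P.labels} := List.getElem_mem _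
  simp only [Option.map_some, Option.getD_some, StepOK] at *
  rw [hf.lt_iff_lt m1 m2, hf.lt_iff_lt m2 m1]
  exact this

/-! ### Heights -/

@[simp] theorem height_zero (P : LPath) : P.height 0 = 0 := by simp [height]

theorem height_cat_left (P : LPath) (x : ℤ) (Q : LPath) {j : ℕ} (h : j ≤ P.steps.length) :
    (P.cat x Q).height j = P.height j := by
  simp [height, List.take_append_of_le_length h]

theorem height_cat_right (P : LPath) (x : ℤ) (Q : LPath) (j : ℕ) :
    (P.cat x Q).height (P.steps.length + 1 + j) = P.height P.steps.length + x + Q.height j := by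
  rw [height, steps_cat, add_assoc, List.take_length_add_append, add_comm 1 j]
  simp [height, add_assoc]

theorem height_succ (P : LPath) {j : ℕ} (h : j < P.steps.length) :
    P.height (j + 1) = P.height j + P.steps.getD j 0 := by
  rw [height, List.take_add_one, List.sum_append, height, List.getD_eq_getElem?_getD,
    List.getElem?_eq_getElem h]
  simp

/-- A partial sum of the reversed path is minus a final sum of `P`. -/
theorem height_rev (P : LPath) (j : ℕ) :
    P.rev.height j = P.height (P.steps.length - j) - P.height P.steps.length := by
  have e := List.sum_take_add_sum_drop P.steps (P.steps.length - j)
  have : P.height P.steps.length = P.steps.sum := by simp [height]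
  rw [this]
  have h2 : P.rev.height j = -(P.steps.drop (P.steps.length - j)).sum := by
    rw [height, rev]
    simp only
    rw [← List.map_take, List.take_reverse, ← List.sum_neg, List.sum_reverse]
  rw [h2, height, ← e]; ring

end LPath
end WellLabelled

/-! ### Motzkin paths, positive paths, and the uniqueness of their cuts. -/

namespace WellLabelled
namespace LPath

/-- Motzkin paths with arbitrary labels. -/
structure Motzkin (P : LPath) : Prop where
  compat : P.Compat
  nonneg : ∀ j < P.steps.length, 0 ≤ P.height j
  height_length : P.height P.steps.length = -1

/-- Positive paths with arbitrary labels. -/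
structure Positive (P : LPath) : Prop where
  compat : P.Compat
  nonneg : ∀ j ≤ P.steps.length, 0 ≤ P.height j

/-- Paths that stay above height one after their first point. -/
structure Above (P : LPath) : Prop where
  compat : P.Compat
  one_le : ∀ j, 1 ≤ j → j ≤ P.steps.length → 1 ≤ P.height j

theorem Motzkin.steps_ne_nil {P : LPath} (h : P.Motzkin) : P.steps ≠ [] := by
  intro h0
  have := h.height_length
  simp [h0] at this

theorem Motzkin.length_pos {P : LPath} (h : P.Motzkin) : 1 ≤ P.steps.length :=
  List.length_pos_iff.2 h.steps_ne_nil

/-- Reversal subtracts the final height `-1`, so heights at least `0` become heights at least `1`.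
Conversely, `Above.motzkin_rev` recovers a Motzkin path from a path that stays above and ends at
height `1`. -/
theorem Motzkin.above_rev {P : LPath} (h : P.Motzkin) : P.rev.Above := by
  refine ⟨h.compat.rev, fun j h1 hj => ?_⟩
  rw [length_steps_rev] at hj
  rw [height_rev, h.height_length]
  linarith [h.nonneg (P.steps.length - j) (by omega)]

theorem Motzkin.height_rev_length {P : LPath} (h : P.Motzkin) :
    P.rev.height P.steps.length = 1 := by
  rw [height_rev, h.height_length]; simp

theorem Above.motzkin_rev {P : LPath} (h : P.Above) (h1 : P.height P.steps.length = 1) :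
    P.rev.Motzkin := by
  refine ⟨h.compat.rev, fun j hj => ?_, ?_⟩
  · rw [length_steps_rev] at hj
    rw [height_rev, h1]
    linarith [h.one_le (P.steps.length - j) (by omega) (by omega)]
  · rw [length_steps_rev, height_rev, h1]; simp

theorem Above.positive {P : LPath} (h : P.Above) : P.Positive := by
  refine ⟨h.compat, fun j hj => ?_⟩
  rcases Nat.eq_zero_or_pos j with rfl | hp
  · simp
  · linarith [h.one_le j hp hj]

theorem Compat.above_of_steps_eq_nil {P : LPath} (h : P.Compat) (h0 : P.steps = []) : P.Above :=
  ⟨h, fun j h1 hj => by simp [h0] at hj; omega⟩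

theorem height_cat_succ (P : LPath) (x : ℤ) (Q : LPath) :
    (P.cat x Q).height (P.steps.length + 1) = P.height P.steps.length + x := by
  simpa using height_cat_right P x Q 0

theorem cat_inj_of_length {P Q P' Q' : LPath} {x x' : ℤ} (hP : P.Compat) (hP' : P'.Compat)
    (h : P.cat x Q = P'.cat x' Q') (hl : P.steps.length = P'.steps.length) :
    P = P' ∧ x = x' ∧ Q = Q' := by
  have h1 := congrArg steps h
  have h2 := congrArg labels h
  simp only [steps_cat, labels_cat] at h1 h2
  have hl2 : P.labels.length = P'.labels.length := by
    rw [hP.length_labels, hP'.length_labels, hl]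
  obtain ⟨a, b⟩ := List.append_inj h1 hl
  obtain ⟨c, d⟩ := List.append_inj h2 hl2
  simp only [List.cons.injEq] at b
  exact ⟨LPath.ext a c, b.1, LPath.ext b.2 d⟩

/-- The first return to height at most zero determines how a path is cut. -/
theorem Above.cat_inj {P Q P' Q' : LPath} {x x' : ℤ} (hP : P.Above) (hP' : P'.Above)
    (hx : P.height P.steps.length + x ≤ 0) (hx' : P'.height P'.steps.length + x' ≤ 0)
    (h : P.cat x Q = P'.cat x' Q') : P = P' ∧ x = x' ∧ Q = Q' := by
  -- If one first part were shorter, its joining step would bring the other first part down to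
  -- height at most `0`.
  have key : ∀ {P Q P' Q' : LPath} {x x' : ℤ}, P'.Above → P.height P.steps.length + x ≤ 0 →
      P.cat x Q = P'.cat x' Q' → ¬ P.steps.length < P'.steps.length := by
    intro P Q P' Q' x x' hP' hx h hlt
    have e := height_cat_succ P x Q
    rw [h, height_cat_left _ _ _ (by omega)] at e
    linarith [hP'.one_le (P.steps.length + 1) (by omega) (by omega)]
  have h1 := key hP' hx h
  have h2 := key hP hx' h.symm
  exact cat_inj_of_length hP.compat hP'.compat h (by omega)

/-- A cut of a positive path: the first part stays above height one and ends at height one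
(unless it is a single point, followed by a step `0`), then comes a nonzero step, and the last
part is positive. -/
structure PosCut (P : LPath) (x : ℤ) (Q : LPath) : Prop where
  above : P.Above
  positive : Q.Positive
  ends : (P.steps = [] ∧ x = 0) ∨
    (P.steps ≠ [] ∧ P.height P.steps.length = 1 ∧ (x = -1 ∨ x = 1))

/-- The part before the cut of a positive path is the longest possible one. -/
theorem PosCut.not_lt {P Q : LPath} {x : ℤ} (h : PosCut P x Q) {r : ℕ}
    (hr : ∀ j, 1 ≤ j → j ≤ r → 1 ≤ (P.cat x Q).height j) (h1 : (P.cat x Q).height r = 1)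
    (hrl : r ≤ (P.cat x Q).steps.length) : ¬ P.steps.length < r := by
  intro hlt
  have e := height_cat_succ P x Q
  have e' := hr (P.steps.length + 1) (by omega) (by omega)
  rcases h.ends with ⟨h0, rfl⟩ | ⟨h0, hh, rfl | rfl⟩
  · rw [e, h0] at e'; simp at e'
  · linarith
  -- After an up step the height is `2`, and `Q` being positive keeps it at least `2`, so it is not
  -- `1` at `r`.
  · obtain ⟨k, rfl⟩ : ∃ k, r = P.steps.length + 1 + k := ⟨r - P.steps.length - 1, by omega⟩
    rw [height_cat_right] at h1
    simp only [steps_cat, List.length_append, List.length_cons] at hrl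
    have := h.positive.nonneg k (by omega)
    linarith

/-- A longer first part would contradict `PosCut.not_lt` for the shorter one, so both have the same
length. -/
theorem PosCut.inj {P Q P' Q' : LPath} {x x' : ℤ} (h : PosCut P x Q) (h' : PosCut P' x' Q')
    (e : P.cat x Q = P'.cat x' Q') : P = P' ∧ x = x' ∧ Q = Q' := by
  have key : ∀ {P Q P' Q' : LPath} {x x' : ℤ}, PosCut P x Q → PosCut P' x' Q' →
      P.cat x Q = P'.cat x' Q' → ¬ P.steps.length < P'.steps.length := by
    intro P Q P' Q' x x' h h' e hlt
    refine h.not_lt (r := P'.steps.length) (fun j h1 hj => ?_) ?_ ?_ hlt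
    · rw [e, height_cat_left _ _ _ hj]; exact h'.above.one_le j h1 hj
    · rw [e, height_cat_left _ _ _ le_rfl]
      rcases h'.ends with ⟨h0, -⟩ | ⟨-, hh, -⟩
      · simp [h0] at hlt
      · exact hh
    · rw [e]; simp
  have h1 := key h h' e
  have h2 := key h' h e.symm
  exact cat_inj_of_length h.above.compat h'.above.compat e (by omega)

/-- This separates the paths of trees marked at the root from the other marked paths: the whole of
`R` would be a longer prefix than the one cut off. -/
theorem PosCut.ne_of_above {P Q R : LPath} {x : ℤ} (h : PosCut P x Q) (hR : R.Above)
    (h1 : R.height R.steps.length = 1) : P.cat x Q ≠ R := by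
  rintro rfl
  exact h.not_lt hR.one_le h1 le_rfl (by simp)

theorem Motzkin.cat {P Q : LPath} {x : ℤ} (hP : P.Above) (hx : StepOK x P.rev.first Q.first)
    (h0 : P.height P.steps.length + x = 0) (hQ : Q.Motzkin) : (P.cat x Q).Motzkin := by
  refine ⟨(Compat.cat_iff hP.compat.length_labels hQ.compat.length_labels).2
    ⟨hP.compat, hx, hQ.compat⟩, fun j hj => ?_, ?_⟩
  · simp only [steps_cat, List.length_append, List.length_cons] at hj
    rcases le_or_gt j P.steps.length with h | h
    · rw [height_cat_left _ _ _ h]; exact hP.positive.nonneg j h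
    · obtain ⟨k, rfl⟩ : ∃ k, j = P.steps.length + 1 + k := ⟨j - P.steps.length - 1, by omega⟩
      rw [height_cat_right, h0, zero_add]; exact hQ.nonneg k (by omega)
  · rw [steps_cat, List.length_append, List.length_cons, add_comm Q.steps.length, ← add_assoc,
      height_cat_right, h0, hQ.height_length, zero_add]

theorem PosCut.positive_cat {P Q : LPath} {x : ℤ} (h : PosCut P x Q)
    (hx : StepOK x P.rev.first Q.first) : (P.cat x Q).Positive := by
  refine ⟨(Compat.cat_iff h.above.compat.length_labels h.positive.compat.length_labels).2
    ⟨h.above.compat, hx, h.positive.compat⟩, fun j hj => ?_⟩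
  simp only [steps_cat, List.length_append, List.length_cons] at hj
  rcases le_or_gt j P.steps.length with hl | hl
  · rw [height_cat_left _ _ _ hl]; exact h.above.positive.nonneg j hl
  · obtain ⟨k, rfl⟩ : ∃ k, j = P.steps.length + 1 + k := ⟨j - P.steps.length - 1, by omega⟩
    rw [height_cat_right]
    have := h.positive.nonneg k (by omega)
    rcases h.ends with ⟨h0, rfl⟩ | ⟨h0, hh, rfl | rfl⟩
    · rw [h0]; simpa using this
    · omega
    · omega

end LPath
end WellLabelled

/-! ### Leaves and vertices of binary trees. -/

namespace WellLabelled
namespace BTree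

theorem leaves_ne_nil : ∀ t : BTree, t.leaves ≠ []
  | leaf a => by simp [leaves]
  | node l r => by simp [leaves, leaves_ne_nil l]

theorem length_leaves_pos (t : BTree) : 0 < t.leaves.length :=
  List.length_pos_iff.2 t.leaves_ne_nil

theorem minLeaf_mem : ∀ t : BTree, t.minLeaf ∈ t.leaves
  | leaf a => by simp [leaves, minLeaf]
  | node l r => by
    rcases min_choice l.minLeaf r.minLeaf with h | h <;>
      simp [leaves, minLeaf, h, minLeaf_mem l, minLeaf_mem r]

@[simp] theorem self_mem_vertices (t : BTree) : t ∈ t.vertices := by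
  cases t <;> simp [vertices]

theorem mem_vertices_node {v l r : BTree} :
    v ∈ (node l r).vertices ↔ v = node l r ∨ v ∈ l.vertices ∨ v ∈ r.vertices := by
  simp [vertices]

theorem leaves_subset {v t : BTree} (h : v ∈ t.vertices) : v.leaves ⊆ t.leaves := by
  induction t with
  | leaf b => simp_all [vertices]
  | node l r hl hr =>
    rcases mem_vertices_node.1 h with rfl | h | h
    · simp
    · intro a ha; simp [leaves, hl h ha]
    · intro a ha; simp [leaves, hr h ha]

theorem length_leaves_le {v t : BTree} (h : v ∈ t.vertices) :
    v.leaves.length ≤ t.leaves.length := by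
  induction t with
  | leaf b => simp_all [vertices]
  | node l r hl hr =>
    rcases mem_vertices_node.1 h with rfl | h | h
    · simp
    · have := hl h; simp only [leaves, List.length_append]; omega
    · have := hr h; simp only [leaves, List.length_append]; omega

theorem vertices_trans {u v t : BTree} (h : u ∈ v.vertices) (h' : v ∈ t.vertices) :
    u ∈ t.vertices := by
  induction t with
  | leaf b => simp_all [vertices]
  | node l r hl hr =>
    rcases mem_vertices_node.1 h' with rfl | h' | h'
    · exact h
    · exact mem_vertices_node.2 (Or.inr (Or.inl (hl h')))
    · exact mem_vertices_node.2 (Or.inr (Or.inr (hr h')))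

theorem left_mem {l r t : BTree} (h : node l r ∈ t.vertices) : l ∈ t.vertices :=
  vertices_trans (by simp [vertices]) h

theorem right_mem {l r t : BTree} (h : node l r ∈ t.vertices) : r ∈ t.vertices :=
  vertices_trans (by simp [vertices]) h

theorem nodup_of_mem {v t : BTree} (ht : t.leaves.Nodup) (h : v ∈ t.vertices) :
    v.leaves.Nodup := by
  induction t with
  | leaf b => simp_all [vertices]
  | node l r hl hr =>
    rcases mem_vertices_node.1 h with rfl | h | h
    · exact ht
    · exact hl (List.nodup_append.1 ht).1 h
    · exact hr (List.nodup_append.1 ht).2.1 h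

theorem normal_of_mem {v t : BTree} (ht : t.Normal) (h : v ∈ t.vertices) : v.Normal := by
  induction t with
  | leaf b => simp_all [vertices]
  | node l r hl hr =>
    rcases mem_vertices_node.1 h with rfl | h | h
    · exact ht
    · exact hl ht.2.1 h
    · exact hr ht.2.2 h

theorem disjoint_of_nodup {l r : BTree} (h : (node l r).leaves.Nodup) :
    l.leaves.Disjoint r.leaves := List.disjoint_of_nodup_append h

/-- A vertex is given as a subtree, so it carries its own leaf labels and cannot lie on two disjoint
sides. -/
theorem not_mem_vertices_of_disjoint {v t u : BTree} (h : t.leaves.Disjoint u.leaves)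
    (hv : v ∈ u.vertices) : v ∉ t.vertices := fun hv' =>
  h (leaves_subset hv' v.minLeaf_mem) (leaves_subset hv v.minLeaf_mem)

/-! ### Joining trees -/

theorem join_cases (t u : BTree) : join t u = node t u ∨ join t u = node u t := by
  unfold join; split_ifs <;> simp

theorem join_comm {t u : BTree} (h : t.minLeaf ≠ u.minLeaf) : join t u = join u t := by
  unfold join; split_ifs <;> first | rfl | omega

theorem Normal.eq_join {l r : BTree} (h : (node l r).Normal) : node l r = join l r := by
  simp [join, h.1]

theorem minLeaf_ne_of_disjoint {t u : BTree} (h : t.leaves.Disjoint u.leaves) :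
    t.minLeaf ≠ u.minLeaf := fun e => h t.minLeaf_mem (e ▸ u.minLeaf_mem)

theorem normal_join {t u : BTree} (h : t.leaves.Disjoint u.leaves) (ht : t.Normal)
    (hu : u.Normal) : (join t u).Normal := by
  have := minLeaf_ne_of_disjoint h
  unfold join
  split_ifs with h'
  · exact ⟨h', ht, hu⟩
  · exact ⟨by omega, hu, ht⟩

theorem leaves_join (t u : BTree) : (join t u).leaves.Perm (t.leaves ++ u.leaves) := by
  rcases join_cases t u with h | h <;> rw [h]
  · exact List.Perm.refl _
  · exact List.perm_append_comm

theorem mem_vertices_join {v t u : BTree} :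
    v ∈ (join t u).vertices ↔ v = join t u ∨ v ∈ t.vertices ∨ v ∈ u.vertices := by
  rcases join_cases t u with h | h <;> rw [h, mem_vertices_node]
  tauto

theorem mem_join_left {v t u : BTree} (h : v ∈ t.vertices) : v ∈ (join t u).vertices :=
  mem_vertices_join.2 (Or.inr (Or.inl h))

theorem mem_join_right {v t u : BTree} (h : v ∈ u.vertices) : v ∈ (join t u).vertices :=
  mem_vertices_join.2 (Or.inr (Or.inr h))

theorem length_leaves_join (t u : BTree) :
    (join t u).leaves.length = t.leaves.length + u.leaves.length := by
  rw [(leaves_join t u).length_eq, List.length_append]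

theorem ne_join_of_mem_right {v t u : BTree} (h : v ∈ u.vertices) : v ≠ join t u := by
  rintro rfl
  have := length_leaves_le h
  rw [length_leaves_join] at this
  have := t.length_leaves_pos
  omega

/-- A vertex other than the root lies in one of the two subtrees of the root. -/
theorem exists_join_of_mem {v t : BTree} (ht : t.Normal) (hd : t.leaves.Nodup)
    (hv : v ∈ t.vertices) (hne : v ≠ t) :
    ∃ A u, t = join A u ∧ v ∈ u.vertices ∧ A.Normal ∧ u.Normal ∧ A.leaves.Nodup ∧
      u.leaves.Nodup ∧ A.leaves.Disjoint u.leaves := by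
  cases t with
  | leaf a => simp_all [vertices]
  | node l r =>
    have hdis := disjoint_of_nodup hd
    have e := ht.eq_join
    obtain ⟨-, hl, hr⟩ := ht
    obtain ⟨hl', hr', -⟩ := List.nodup_append.1 hd
    rcases mem_vertices_node.1 hv with h | h | h
    · exact absurd h hne
    · exact ⟨r, l, by rw [e, join_comm (minLeaf_ne_of_disjoint hdis)], h, hr, hl, hr', hl',
        hdis.symm⟩
    · exact ⟨l, r, e, h, hl, hr, hl', hr', hdis⟩

/-! ### Relabelling trees -/

theorem leaves_relabel (f : ℕ → ℕ) : ∀ t : BTree, (t.relabel f).leaves.Perm (t.leaves.map f)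
  | leaf a => by simp [relabel, leaves]
  | node l r => by
    simp only [relabel, leaves, List.map_append]
    exact (leaves_join _ _).trans ((leaves_relabel f l).append (leaves_relabel f r))

theorem disjoint_relabel {f : ℕ → ℕ} {t u : BTree} (h : t.leaves.Disjoint u.leaves)
    (hf : Set.InjOn f {a | a ∈ t.leaves ∨ a ∈ u.leaves}) :
    (t.relabel f).leaves.Disjoint (u.relabel f).leaves := by
  intro a ha hb
  rw [(leaves_relabel f t).mem_iff, List.mem_map] at ha
  rw [(leaves_relabel f u).mem_iff, List.mem_map] at hb
  obtain ⟨b, hb1, rfl⟩ := ha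
  obtain ⟨c, hc1, hc⟩ := hb
  exact h hb1 (hf (Or.inr hc1) (Or.inl hb1) hc ▸ hc1)

theorem nodup_relabel {f : ℕ → ℕ} {t : BTree} (h : t.leaves.Nodup)
    (hf : Set.InjOn f {a | a ∈ t.leaves}) : (t.relabel f).leaves.Nodup :=
  (leaves_relabel f t).nodup_iff.2 (List.Nodup.map_on (fun _ ha _ hb e => hf ha hb e) h)

/-- `relabel` rebuilds every internal vertex with `join`, which sorts the two children; injectivity
only excludes ties. -/
theorem normal_relabel {f : ℕ → ℕ} {t : BTree} (h : t.leaves.Nodup)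
    (hf : Set.InjOn f {a | a ∈ t.leaves}) : (t.relabel f).Normal := by
  induction t with
  | leaf a => trivial
  | node l r hl hr =>
    obtain ⟨hl', hr', -⟩ := List.nodup_append.1 h
    refine normal_join (disjoint_relabel (disjoint_of_nodup h) ?_) (hl hl' ?_) (hr hr' ?_)
    · simpa [leaves] using hf
    · exact hf.mono fun a (ha : a ∈ l.leaves) => by simp [leaves, ha]
    · exact hf.mono fun a (ha : a ∈ r.leaves) => by simp [leaves, ha]

theorem relabel_mem_vertices (f : ℕ → ℕ) {v t : BTree} (h : v ∈ t.vertices) :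
    v.relabel f ∈ (t.relabel f).vertices := by
  induction t with
  | leaf a => simp_all [vertices]
  | node l r hl hr =>
    rcases mem_vertices_node.1 h with rfl | h | h
    · simp
    · exact mem_join_left (hl h)
    · exact mem_join_right (hr h)

end BTree
end WellLabelled

/-! ### The coding of trees and marked trees by paths. -/

namespace WellLabelled
open BTree
namespace LPath

/-- Either a single point or a Motzkin path. -/
structure TreeLike (P : LPath) : Prop where
  compat : P.Compat
  motzkin : P.steps = [] ∨ P.Motzkin

/-- The path obtained by concatenating two tree-like paths, one of which is read backward. -/
def merge (P Q : LPath) : LPath :=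
  if P.steps = [] ∧ Q.steps ≠ [] then P.cat 0 Q
  else if Q.steps = [] ∧ P.steps ≠ [] then Q.cat 0 P
  else if P.first < Q.first then P.rev.cat (-1) Q else Q.rev.cat (-1) P

/-- Children are unordered, so the coding may not depend on which subtree is written first; only a
tie between first labels could spoil this. -/
theorem merge_comm {P Q : LPath} (h : P.first ≠ Q.first) : P.merge Q = Q.merge P := by
  unfold merge
  by_cases hP : P.steps = [] <;> by_cases hQ : Q.steps = [] <;> simp [hP, hQ] <;>
    split_ifs <;> first | rfl | omega

/-- The shape of the two parts of a merged path. -/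
structure MergeCut (P : LPath) (x : ℤ) (Q : LPath) : Prop where
  above : P.rev.Above
  step : StepOK x P.first Q.first
  ends : (P.steps = [] ∧ Q.steps = [] ∧ x = -1) ∨
    (P.rev.height P.rev.steps.length + x = 0 ∧ Q.Motzkin)

theorem MergeCut.le {P Q : LPath} {x : ℤ} (h : MergeCut P x Q) :
    P.rev.height P.rev.steps.length + x ≤ 0 := by
  rcases h.ends with ⟨h0, -, rfl⟩ | ⟨h, -⟩
  · simp [h0]
  · exact h.le

theorem TreeLike.above_rev {P : LPath} (h : P.TreeLike) : P.rev.Above := by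
  rcases h.motzkin with h0 | h0
  · exact h.compat.rev.above_of_steps_eq_nil (by simp [rev, h0])
  · exact h0.above_rev

theorem MergeCut.motzkin {P Q : LPath} {x : ℤ} (h : MergeCut P x Q) (hQ : Q.Compat) :
    (P.rev.cat x Q).Motzkin := by
  rcases h.ends with ⟨h0, h1, rfl⟩ | ⟨h0, h1⟩
  · have e1 : P.rev.steps = [] := by simp [rev, h0]
    refine ⟨(Compat.cat_iff h.above.compat.length_labels hQ.length_labels).2
      ⟨h.above.compat, by simpa using h.step, hQ⟩, fun j hj => ?_, ?_⟩
    · simp [e1, h1] at hj; simp [hj]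
    · simp [height, e1, h1]
  · exact Motzkin.cat h.above (by simpa using h.step) h0 h1

/-- A one-point path equals its reversal, so all four branches of `merge` have the same shape: one
part read backward, a step, and the other part. -/
theorem merge_cases {P Q : LPath} (hP : P.TreeLike) (hQ : Q.TreeLike) (hne : P.first ≠ Q.first) :
    ∃ x, (P.merge Q = P.rev.cat x Q ∧ MergeCut P x Q) ∨
      (P.merge Q = Q.rev.cat x P ∧ MergeCut Q x P) := by
  unfold merge
  have rP := hP.motzkin.imp_right Motzkin.height_rev_length
  have rQ := hQ.motzkin.imp_right Motzkin.height_rev_length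
  split_ifs with h1 h2 h3
  · refine ⟨0, Or.inl ⟨by rw [hP.compat.rev_eq_self h1.1], hP.above_rev, by simp [StepOK], ?_⟩⟩
    exact Or.inr ⟨by simp [h1.1], hQ.motzkin.resolve_left h1.2⟩
  · refine ⟨0, Or.inr ⟨by rw [hQ.compat.rev_eq_self h2.1], hQ.above_rev, by simp [StepOK], ?_⟩⟩
    exact Or.inr ⟨by simp [h2.1], hP.motzkin.resolve_left h2.2⟩
  · refine ⟨-1, Or.inl ⟨rfl, hP.above_rev, Or.inl ⟨rfl, h3⟩, ?_⟩⟩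
    by_cases h0 : P.steps = []
    · exact Or.inl ⟨h0, by tauto, rfl⟩
    · exact Or.inr ⟨by simp [rP.resolve_left h0], hQ.motzkin.resolve_left (by tauto)⟩
  · refine ⟨-1, Or.inr ⟨rfl, hQ.above_rev, Or.inl ⟨rfl, by omega⟩, ?_⟩⟩
    by_cases h0 : Q.steps = []
    · exact Or.inl ⟨h0, by tauto, rfl⟩
    · exact Or.inr ⟨by simp [rQ.resolve_left h0], hP.motzkin.resolve_left (by tauto)⟩

theorem merge_map {P Q : LPath} (hP : P.Compat) (hQ : Q.Compat) {f : ℕ → ℕ}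
    (hf : StrictMonoOn f {a | a ∈ P.labels ∨ a ∈ Q.labels}) :
    (P.map f).merge (Q.map f) = (P.merge Q).map f := by
  have := hf.lt_iff_lt (Or.inl hP.first_mem) (Or.inr hQ.first_mem)
  unfold merge
  rw [hP.first_map, hQ.first_map]
  simp only [this, steps_map, map_rev, map_cat]
  split_ifs <;> rfl

/-- The path obtained from a tree-like path, read backward, followed by a positive one. -/
def mergeMarked (P Q : LPath) : LPath :=
  P.rev.cat (if P.steps = [] then 0 else if P.first < Q.first then -1 else 1) Q

theorem mergeMarked_map {P Q : LPath} (hP : P.Compat) (hQ : Q.Compat) {f : ℕ → ℕ}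
    (hf : StrictMonoOn f {a | a ∈ P.labels ∨ a ∈ Q.labels}) :
    (P.map f).mergeMarked (Q.map f) = (P.mergeMarked Q).map f := by
  have := hf.lt_iff_lt (Or.inl hP.first_mem) (Or.inr hQ.first_mem)
  unfold mergeMarked
  rw [hP.first_map, hQ.first_map]
  simp only [this, steps_map, map_rev, map_cat]

theorem TreeLike.posCut {P Q : LPath} (hP : P.TreeLike) (hQ : Q.Positive) :
    PosCut P.rev (if P.steps = [] then 0 else if P.first < Q.first then -1 else 1) Q := by
  refine ⟨hP.above_rev, hQ, ?_⟩
  by_cases h0 : P.steps = []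
  · left; simp [rev, h0]
  · right
    refine ⟨by simp [rev, h0], ?_, by simp only [h0, if_false]; split_ifs <;> simp⟩
    simpa using (hP.motzkin.resolve_left h0).height_rev_length

theorem TreeLike.positive_mergeMarked {P Q : LPath} (hP : P.TreeLike) (hQ : Q.Positive)
    (hne : P.first ≠ Q.first) : (P.mergeMarked Q).Positive := by
  refine (hP.posCut hQ).positive_cat ?_
  rw [rev_rev]
  unfold StepOK
  split_ifs <;> omega

end LPath

open LPath

/-- The path coded by a tree. -/
def treePath : BTree → LPath
  | leaf a => ⟨[], [a]⟩
  | node l r => (treePath l).merge (treePath r)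

/-- The path coded by a tree with a marked vertex `v`. -/
def markedPath (v : BTree) : BTree → LPath
  | leaf a => ⟨[], [a]⟩
  | node l r =>
    if v = node l r then (treePath (node l r)).rev
    else if v ∈ l.vertices then (treePath r).mergeMarked (markedPath v l)
    else (treePath l).mergeMarked (markedPath v r)

theorem labels_merge (P Q : LPath) : (P.merge Q).labels.Perm (P.labels ++ Q.labels) := by
  unfold merge
  split_ifs <;> simp only [labels_cat, labels_rev]
  · exact List.Perm.refl _
  · exact List.perm_append_comm
  · exact (List.reverse_perm _).append_right _
  · exact ((List.reverse_perm _).append_right _).trans List.perm_append_comm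

theorem labels_mergeMarked (P Q : LPath) :
    (P.mergeMarked Q).labels.Perm (P.labels ++ Q.labels) := by
  unfold mergeMarked
  simp only [labels_cat, labels_rev]
  exact (List.reverse_perm _).append_right _

theorem labels_treePath : ∀ t : BTree, (treePath t).labels.Perm t.leaves
  | leaf a => by simp [treePath, leaves]
  | node l r => (labels_merge _ _).trans ((labels_treePath l).append (labels_treePath r))

theorem labels_markedPath (v : BTree) : ∀ t : BTree, (markedPath v t).labels.Perm t.leaves
  | leaf a => by simp [markedPath, leaves]
  | node l r => by
    unfold markedPath
    split_ifs
    · exact (List.reverse_perm _).trans (labels_treePath _)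
    · exact (labels_mergeMarked _ _).trans
        (((labels_treePath r).append (labels_markedPath v l)).trans List.perm_append_comm)
    · exact (labels_mergeMarked _ _).trans ((labels_treePath l).append (labels_markedPath v r))

theorem first_ne_of_disjoint {t u : BTree} {P Q : LPath} (h : t.leaves.Disjoint u.leaves)
    (hP : P.Compat) (hQ : Q.Compat) (hPt : P.labels.Perm t.leaves)
    (hQu : Q.labels.Perm u.leaves) : P.first ≠ Q.first := fun e =>
  h (hPt.mem_iff.1 hP.first_mem) (hQu.mem_iff.1 (e ▸ hQ.first_mem))

theorem compat_singleton (a : ℕ) : (LPath.mk [] [a]).Compat := ⟨by simp, fun i hi => by simp at hi⟩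

theorem treeLike_treePath {t : BTree} (h : t.leaves.Nodup) : (treePath t).TreeLike := by
  induction t with
  | leaf a => exact ⟨compat_singleton a, Or.inl rfl⟩
  | node l r hl hr =>
    obtain ⟨hl', hr', -⟩ := List.nodup_append.1 h
    have hl := hl hl'
    have hr := hr hr'
    have hne := first_ne_of_disjoint (disjoint_of_nodup h) hl.compat hr.compat
      (labels_treePath l) (labels_treePath r)
    have : (treePath (node l r)).Motzkin := by
      obtain ⟨x, ⟨e, c⟩ | ⟨e, c⟩⟩ := merge_cases hl hr hne
      · rw [treePath, e]; exact c.motzkin hr.compat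
      · rw [treePath, e]; exact c.motzkin hl.compat
    exact ⟨this.compat, Or.inr this⟩

theorem treePath_first_ne {t u : BTree} (ht : t.leaves.Nodup) (hu : u.leaves.Nodup)
    (h : t.leaves.Disjoint u.leaves) : (treePath t).first ≠ (treePath u).first :=
  first_ne_of_disjoint h (treeLike_treePath ht).compat (treeLike_treePath hu).compat
      (labels_treePath t) (labels_treePath u)

theorem treePath_join {t u : BTree} (ht : t.leaves.Nodup) (hu : u.leaves.Nodup)
    (h : t.leaves.Disjoint u.leaves) : treePath (join t u) = (treePath t).merge (treePath u) := by
  rcases join_cases t u with e | e <;> rw [e, treePath]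
  exact merge_comm (treePath_first_ne hu ht h.symm)

theorem length_steps_treePath {t : BTree} (h : t.leaves.Nodup) :
    (treePath t).steps.length + 1 = t.leaves.length := by
  rw [← (labels_treePath t).length_eq, (treeLike_treePath h).compat.length_labels]

/-- Monotonicity is needed because `merge` compares the first labels of the two parts. -/
theorem treePath_relabel {f : ℕ → ℕ} {t : BTree} (h : t.leaves.Nodup)
    (hf : StrictMonoOn f {a | a ∈ t.leaves}) : treePath (t.relabel f) = (treePath t).map f := by
  induction t with
  | leaf a => simp [treePath, relabel, LPath.map]
  | node l r hl hr =>
    obtain ⟨hl', hr', -⟩ := List.nodup_append.1 h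
    have hd := disjoint_of_nodup h
    have fl : StrictMonoOn f {a | a ∈ l.leaves} :=
      hf.mono fun a (ha : a ∈ l.leaves) => by simp [leaves, ha]
    have fr : StrictMonoOn f {a | a ∈ r.leaves} :=
      hf.mono fun a (ha : a ∈ r.leaves) => by simp [leaves, ha]
    have f2 : StrictMonoOn f {a | a ∈ l.leaves ∨ a ∈ r.leaves} := by simpa [leaves] using hf
    rw [relabel, treePath_join (nodup_relabel hl' fl.injOn) (nodup_relabel hr' fr.injOn)
      (disjoint_relabel hd f2.injOn), hl hl' fl, hr hr' fr, treePath]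
    refine merge_map (treeLike_treePath hl').compat (treeLike_treePath hr').compat ?_
    simpa [(labels_treePath l).mem_iff, (labels_treePath r).mem_iff] using f2

/-! ### Marked trees -/

theorem markedPath_self {t : BTree} (h : t.leaves.Nodup) : markedPath t t = (treePath t).rev := by
  cases t with
  | leaf a => simp [markedPath, treePath, rev]
  | node l r => simp [markedPath]

theorem markedPath_join {v t u : BTree} (hv : v ∈ u.vertices)
    (h : t.leaves.Disjoint u.leaves) :
    markedPath v (join t u) = (treePath t).mergeMarked (markedPath v u) := by
  have h1 := ne_join_of_mem_right (t := t) hv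
  have h2 := not_mem_vertices_of_disjoint h hv
  rcases join_cases t u with e | e <;> rw [e] at h1 ⊢ <;> simp [markedPath, h1, h2, hv]

theorem positive_markedPath {v t : BTree} (ht : t.Normal) (h : t.leaves.Nodup)
    (hv : v ∈ t.vertices) : (markedPath v t).Positive := by
  induction hn : t.leaves.length using Nat.strong_induction_on generalizing t with
  | _ n ih =>
    by_cases hvt : v = t
    · subst hvt
      rw [markedPath_self h]
      exact (treeLike_treePath h).above_rev.positive
    · obtain ⟨A, u, rfl, hvu, hA, hu, hA', hu', hd⟩ := exists_join_of_mem ht h hv hvt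
      have hp := ih u.leaves.length
        (by rw [← hn, length_leaves_join]; have := A.length_leaves_pos; omega) hu hu' hvu rfl
      rw [markedPath_join hvu hd]
      exact (treeLike_treePath hA').positive_mergeMarked hp
        (first_ne_of_disjoint hd (treeLike_treePath hA').compat hp.compat (labels_treePath A)
          (labels_markedPath v u))

theorem markedPath_relabel {f : ℕ → ℕ} {v t : BTree} (ht : t.Normal) (h : t.leaves.Nodup)
    (hv : v ∈ t.vertices) (hf : StrictMonoOn f {a | a ∈ t.leaves}) :
    markedPath (v.relabel f) (t.relabel f) = (markedPath v t).map f := by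
  induction t with
  | leaf a => simp [markedPath, relabel, LPath.map]
  | node l r hl hr =>
    have hN := ht
    obtain ⟨-, nl, nr⟩ := ht
    obtain ⟨hl', hr', -⟩ := List.nodup_append.1 h
    have hd := disjoint_of_nodup h
    have fl : StrictMonoOn f {a | a ∈ l.leaves} :=
      hf.mono fun a (ha : a ∈ l.leaves) => by simp [leaves, ha]
    have fr : StrictMonoOn f {a | a ∈ r.leaves} :=
      hf.mono fun a (ha : a ∈ r.leaves) => by simp [leaves, ha]
    have f2 : StrictMonoOn f {a | a ∈ l.leaves ∨ a ∈ r.leaves} := by simpa [leaves] using hf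
    have hdr := disjoint_relabel hd f2.injOn
    rcases mem_vertices_node.1 hv with rfl | h' | h'
    · rw [markedPath_self h, markedPath_self (nodup_relabel h hf.injOn), treePath_relabel h hf,
        map_rev]
    · rw [relabel, join_comm (minLeaf_ne_of_disjoint hdr),
        markedPath_join (relabel_mem_vertices f h') hdr.symm, hl nl hl' h' fl,
        treePath_relabel hr' fr, hN.eq_join, join_comm (minLeaf_ne_of_disjoint hd),
        markedPath_join h' hd.symm]
      refine mergeMarked_map (treeLike_treePath hr').compat
        (positive_markedPath nl hl' h').compat ?_
      simpa [(labels_treePath r).mem_iff, (labels_markedPath v l).mem_iff, or_comm] using f2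
    · rw [relabel, markedPath_join (relabel_mem_vertices f h') hdr, hr nr hr' h' fr,
        treePath_relabel hl' fl, hN.eq_join, markedPath_join h' hd]
      refine mergeMarked_map (treeLike_treePath hl').compat
        (positive_markedPath nr hr' h').compat ?_
      simpa [(labels_treePath l).mem_iff, (labels_markedPath v r).mem_iff] using f2

/-! ### Trees are determined by their paths -/

/-- The path of a tree with at least two leaves is cut into the paths of the two subtrees. -/
theorem exists_mergeCut {t : BTree} (ht : t.Normal) (h : t.leaves.Nodup)
    (h2 : (treePath t).steps ≠ []) :
    ∃ A B x, t = join A B ∧ A.Normal ∧ B.Normal ∧ A.leaves.Nodup ∧ B.leaves.Nodup ∧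
      treePath t = (treePath A).rev.cat x (treePath B) ∧
      MergeCut (treePath A) x (treePath B) := by
  cases t with
  | leaf a => simp [treePath] at h2
  | node l r =>
    obtain ⟨hl', hr', -⟩ := List.nodup_append.1 h
    have hd := disjoint_of_nodup h
    have e := ht.eq_join
    obtain ⟨-, nl, nr⟩ := ht
    obtain ⟨x, c | c⟩ := merge_cases (treeLike_treePath hl') (treeLike_treePath hr')
      (treePath_first_ne hl' hr' hd)
    · exact ⟨l, r, x, e, nl, nr, hl', hr', c.1, c.2⟩
    · exact ⟨r, l, x, by rw [e, join_comm (minLeaf_ne_of_disjoint hd)], nr, nl, hr', hl', c.1,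
        c.2⟩

/-- The cut at the first return is unique, so equal paths have equal parts, and induction applies to
the two subtrees. The `join` of these does not depend on how they were written. -/
theorem treePath_inj {t t' : BTree} (ht : t.Normal) (ht' : t'.Normal) (h : t.leaves.Nodup)
    (h' : t'.leaves.Nodup) (e : treePath t = treePath t') : t = t' := by
  induction hn : t.leaves.length using Nat.strong_induction_on generalizing t t' with
  | _ n ih =>
    by_cases h0 : (treePath t).steps = []
    · have l1 := length_steps_treePath h
      have l2 := length_steps_treePath h'
      rw [← e] at l2
      cases t with
      | node l r =>
        have := l.length_leaves_pos
        have := r.length_leaves_pos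
        simp [h0, leaves] at l1; omega
      | leaf a =>
        cases t' with
        | node l r =>
          have := l.length_leaves_pos
          have := r.length_leaves_pos
          simp [h0, leaves] at l2; omega
        | leaf b => simpa [treePath] using e
    · obtain ⟨A, B, x, rfl, nA, nB, hA, hB, eP, c⟩ := exists_mergeCut ht h h0
      obtain ⟨A', B', x', rfl, nA', nB', hA', hB', eP', c'⟩ :=
        exists_mergeCut ht' h' (e ▸ h0)
      rw [eP, eP'] at e
      obtain ⟨e1, -, e3⟩ := c.above.cat_inj c'.above c.le c'.le e
      have e1' : treePath A = treePath A' := by rw [← rev_rev (treePath A), e1, rev_rev]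
      have := A.length_leaves_pos
      have := B.length_leaves_pos
      rw [length_leaves_join] at hn
      rw [ih A.leaves.length (by omega) nA nA' hA hA' e1' rfl,
        ih B.leaves.length (by omega) nB nB' hB hB' e3 rfl]

/-- The path tells whether the root is marked; if it is not, the unique cut separates the unmarked
subtree, recovered by `treePath_inj`, from the marked one, recovered by induction. -/
theorem markedPath_inj {v v' t t' : BTree} (ht : t.Normal) (ht' : t'.Normal)
    (h : t.leaves.Nodup) (h' : t'.leaves.Nodup) (hv : v ∈ t.vertices) (hv' : v' ∈ t'.vertices)
    (e : markedPath v t = markedPath v' t') : t = t' ∧ v = v' := by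
  -- A path with a cut is never that of a tree marked at its root: a single leaf has no step, and a
  -- larger tree gives a prefix longer than the cut.
  have key : ∀ {A u t v : BTree}, A.leaves.Nodup → u.Normal → u.leaves.Nodup → v ∈ u.vertices →
      t.leaves.Nodup → (treePath A).mergeMarked (markedPath v u) ≠ (treePath t).rev := by
    intro A u t v hA nu hu hv ht e
    have hp := positive_markedPath nu hu hv
    rcases (treeLike_treePath ht).motzkin with h0 | h0
    · have := congrArg steps e
      simp [rev, h0, mergeMarked] at this
    · exact ((treeLike_treePath hA).posCut hp).ne_of_above h0.above_rev
        (by simpa using h0.height_rev_length) e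
  induction hn : t.leaves.length using Nat.strong_induction_on generalizing t t' with
  | _ n ih =>
    by_cases hvt : v = t
    · subst hvt
      rw [markedPath_self h] at e
      by_cases hvt' : v' = t'
      · subst hvt'
        rw [markedPath_self h'] at e
        have e' : treePath v = treePath v' := by rw [← rev_rev (treePath v), e, rev_rev]
        have := treePath_inj ht ht' h h' e'
        exact ⟨this, this⟩
      · obtain ⟨A, u, rfl, hvu, hA, hu, hA', hu', hd⟩ := exists_join_of_mem ht' h' hv' hvt'
        rw [markedPath_join hvu hd] at e
        exact absurd e.symm (key hA' hu hu' hvu h)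
    · obtain ⟨A, u, rfl, hvu, hA, hu, hA', hu', hd⟩ := exists_join_of_mem ht h hv hvt
      rw [markedPath_join hvu hd] at e
      by_cases hvt' : v' = t'
      · subst hvt'
        rw [markedPath_self h'] at e
        exact absurd e (key hA' hu hu' hvu h')
      · obtain ⟨B, w, rfl, hvw, hB, hw, hB', hw', hd'⟩ := exists_join_of_mem ht' h' hv' hvt'
        rw [markedPath_join hvw hd'] at e
        obtain ⟨e1, -, e3⟩ := ((treeLike_treePath hA').posCut
          (positive_markedPath hu hu' hvu)).inj ((treeLike_treePath hB').posCut
          (positive_markedPath hw hw' hvw)) e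
        have e1' : treePath A = treePath B := by rw [← rev_rev (treePath A), e1, rev_rev]
        have := A.length_leaves_pos
        rw [length_leaves_join] at hn
        obtain ⟨rfl, rfl⟩ := ih u.leaves.length (by omega) hu hw hu' hw' hvu hvw e3 rfl
        rw [treePath_inj hA hB hA' hB' e1']
        exact ⟨rfl, rfl⟩

end WellLabelled

namespace WellLabelled
open BTree

/-! ### Standardization -/

theorem lam_lamInv {I : Finset ℕ} {x : ℕ} (h : x ∈ I) : lam I (lamInv I x) = x := by
  unfold lam lamInv
  rw [Nat.add_sub_cancel]
  exact Nat.nth_count (p := fun y => y ∈ I) h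

theorem lamInv_strictMonoOn (I : Finset ℕ) : StrictMonoOn (lamInv I) {x | x ∈ I} := by
  intro x hx y _ hxy
  exact Nat.add_lt_add_right (Nat.count_strict_mono (p := fun y => y ∈ I) hx hxy) 1

theorem lamInv_le_card {I : Finset ℕ} {x : ℕ} (h : x ∈ I) : lamInv I x ≤ I.card := by
  have hf : {y | y ∈ I}.Finite := I.finite_toSet
  have := Nat.count_lt_card (p := fun y => y ∈ I) hf h
  have e : hf.toFinset = I := by ext; simp
  rw [e] at this
  exact this

theorem lam_strictMonoOn (I : Finset ℕ) : StrictMonoOn (lam I) (Set.Icc 1 I.card) := by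
  have hf : {y | y ∈ I}.Finite := I.finite_toSet
  have e : hf.toFinset = I := by ext; simp
  intro x hx y hy hxy
  have := Nat.nth_strictMonoOn (p := fun y => y ∈ I) hf
  rw [e] at this
  have h1 := hx.1
  have h2 := hy.2
  exact this (show x - 1 < I.card by omega) (show y - 1 < I.card by omega)
    (show x - 1 < y - 1 by omega)

theorem map_lam_standardize (w : List ℕ) : (standardize w).map (lam w.toFinset) = w := by
  rw [standardize, List.map_map]
  conv_rhs => rw [← List.map_id w]
  exact List.map_congr_left fun x hx => lam_lamInv (List.mem_toFinset.2 hx)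

theorem standardize_perm {w : List ℕ} (h : w.Nodup) :
    (standardize w).Perm (List.range' 1 w.length) := by
  have hn : (standardize w).Nodup := List.Nodup.map_on (fun x hx y hy e =>
    (lamInv_strictMonoOn w.toFinset).injOn (List.mem_toFinset.2 hx) (List.mem_toFinset.2 hy) e) h
  -- There are as many distinct letters as there are values in the range, so inclusion is enough.
  refine (List.subperm_of_subset hn fun a ha => ?_).perm_of_length_le (by simp [standardize])
  obtain ⟨x, hx, rfl⟩ := List.mem_map.1 ha
  have h1 := lamInv_le_card (List.mem_toFinset.2 hx)
  rw [List.toFinset_card_of_nodup h] at h1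
  rw [List.mem_range'_1]
  exact ⟨by simp [lamInv], by omega⟩

namespace LPath

/-- The path with standardized labels. -/
def std (P : LPath) : LPath := P.map (lamInv P.labels.toFinset)

theorem std_map_lam (P : LPath) : P.std.map (lam P.labels.toFinset) = P := by
  ext1
  · rfl
  · exact map_lam_standardize P.labels

theorem Compat.std {P : LPath} (h : P.Compat) : P.std.Compat :=
  h.map (by simpa using lamInv_strictMonoOn P.labels.toFinset)

theorem Motzkin.std {P : LPath} (h : P.Motzkin) : P.std.Motzkin :=
  ⟨h.compat.std, h.nonneg, h.height_length⟩

theorem Positive.std {P : LPath} (h : P.Positive) : P.std.Positive := ⟨h.compat.std, h.nonneg⟩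

/-- `P` has `P.steps.length + 1` points, so cutting after that many points removes exactly the
joining step. With `revPrefix_cat` and the two statements on label sets, this rewrites the recursive
calls of both path maps in terms of concatenation. -/
theorem suffix_cat {P : LPath} (hP : P.Compat) (x : ℤ) (Q : LPath) :
    (P.cat x Q).suffix (P.steps.length + 1) = Q.std := by
  ext1
  · rw [suffix, steps_cat, List.drop_length_add_append]
    rfl
  · rw [suffix, ← hP.length_labels, labels_cat, List.drop_left]
    rfl

theorem suffixLabels_cat {P : LPath} (hP : P.Compat) (x : ℤ) (Q : LPath) :
    (P.cat x Q).suffixLabels (P.steps.length + 1) = Q.labels.toFinset := by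
  rw [suffixLabels, ← hP.length_labels, labels_cat, List.drop_left]

theorem revPrefix_cat {P : LPath} (hP : P.Compat) (x : ℤ) (Q : LPath) :
    (P.cat x Q).revPrefix (P.steps.length + 1) = P.rev.std := by
  ext1
  · rw [revPrefix, steps_cat, Nat.add_sub_cancel, List.take_left]
    rfl
  · rw [revPrefix, ← hP.length_labels, labels_cat, List.take_left]
    rfl

theorem revPrefix_size {P : LPath} (hP : P.Compat) : P.revPrefix P.size = P.rev.std := by
  ext1
  · rw [revPrefix, size, hP.length_labels, Nat.add_sub_cancel, List.take_length]
    rfl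
  · rw [revPrefix, size, List.take_length]
    rfl

theorem prefixLabels_cat {P : LPath} (hP : P.Compat) (x : ℤ) (Q : LPath) :
    (P.cat x Q).prefixLabels (P.steps.length + 1) = P.rev.labels.toFinset := by
  rw [prefixLabels, ← hP.length_labels, labels_cat, List.take_left, labels_rev]
  simp

/-- The number `k` counts the steps before the joining one, so the first part has `k + 1` points. -/
theorem Compat.exists_cat {P : LPath} (h : P.Compat) {k : ℕ} (hk : k < P.steps.length) :
    ∃ (R : LPath) (x : ℤ) (Q : LPath), P = R.cat x Q ∧ R.steps.length = k ∧
      R.Compat ∧ StepOK x R.rev.first Q.first ∧ Q.Compat := by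
  have e : P = (LPath.mk (P.steps.take k) (P.labels.take (k + 1))).cat (P.steps[k])
      ⟨P.steps.drop (k + 1), P.labels.drop (k + 1)⟩ := by
    ext1 <;> simp [cat]
  have hl := h.length_labels
  have := h
  rw [e, Compat.cat_iff (by simp; omega) (by simp; omega)] at this
  exact ⟨_, _, _, e, by simp; omega, this⟩

end LPath

/-! ### The map `Φ` as the inverse of the coding. -/

open LPath

theorem isWellLabelled_iff {n : ℕ} {P : LPath} :
    IsWellLabelled n P ↔ P.Compat ∧ P.labels.Perm (List.range' 1 n) := by
  constructor
  · intro h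
    have hl := h.perm_labels.length_eq
    have hs := h.length_steps
    rw [List.length_range'] at hl
    refine ⟨⟨by omega, fun i hi => ?_⟩, h.perm_labels⟩
    have h1 := h.lt_of_down i hi
    have h2 := h.gt_of_up i hi
    have hm : P.steps.getD i 0 ∈ P.steps := by
      rw [List.getD_eq_getElem _ _ hi]; exact List.getElem_mem _
    rcases h.mem_steps _ hm with h3 | h3 | h3
    · exact Or.inl ⟨h3, h1 h3⟩
    · exact Or.inr (Or.inl h3)
    · exact Or.inr (Or.inr ⟨h3, h2 h3⟩)
  · rintro ⟨h, hp⟩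
    have hl := hp.length_eq
    rw [List.length_range', h.length_labels] at hl
    refine ⟨hl, fun s hs => ?_, hp, fun i hi e => ?_, fun i hi e => ?_⟩
    · obtain ⟨i, hi, rfl⟩ := List.getElem_of_mem hs
      have := h.step i hi
      rw [List.getD_eq_getElem _ _ hi] at this
      unfold StepOK at this
      tauto
    · have := h.step i hi
      rw [e] at this
      simpa [StepOK] using this
    · have := h.step i hi
      rw [e] at this
      simpa [StepOK] using this

theorem mem_motzkinPaths {n : ℕ} {P : LPath} :
    P ∈ motzkinPaths n ↔ P.Motzkin ∧ P.labels.Perm (List.range' 1 n) := by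
  unfold motzkinPaths
  rw [Set.mem_ofPred_eq, isWellLabelled_iff]
  constructor
  · rintro ⟨⟨hc, hp⟩, h1, h2⟩
    have hl := hp.length_eq
    rw [List.length_range', hc.length_labels] at hl
    subst hl
    refine ⟨⟨hc, fun j hj => ?_, h2⟩, hp⟩
    rcases Nat.eq_zero_or_pos j with rfl | hj'
    · simp
    · exact h1 j hj' (by omega)
  · rintro ⟨h, hp⟩
    have hl := hp.length_eq
    rw [List.length_range', h.compat.length_labels] at hl
    subst hl
    exact ⟨⟨h.compat, hp⟩, fun j _ hj => h.nonneg j (by omega), h.height_length⟩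

theorem mem_positivePaths {n : ℕ} {P : LPath} :
    P ∈ positivePaths n ↔ P.Positive ∧ P.labels.Perm (List.range' 1 n) := by
  unfold positivePaths
  rw [Set.mem_ofPred_eq, isWellLabelled_iff]
  constructor
  · rintro ⟨⟨hc, hp⟩, h1⟩
    have hl := hp.length_eq
    rw [List.length_range', hc.length_labels] at hl
    subst hl
    refine ⟨⟨hc, fun j hj => ?_⟩, hp⟩
    rcases Nat.eq_zero_or_pos j with rfl | hj'
    · simp
    · exact h1 j hj' (by omega)
  · rintro ⟨h, hp⟩
    have hl := hp.length_eq
    rw [List.length_range', h.compat.length_labels] at hl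
    subst hl
    exact ⟨⟨h.compat, hp⟩, fun j _ hj => h.nonneg j (by omega)⟩

theorem nodup_of_perm_range {n : ℕ} {w : List ℕ} (h : w.Perm (List.range' 1 n)) : w.Nodup :=
  h.nodup_iff.2 List.nodup_range'

theorem nodup_of_mem_labelledTrees {n : ℕ} {t : BTree} (h : t ∈ labelledTrees n) :
    t.leaves.Nodup := nodup_of_perm_range h.1

theorem lam_strictMonoOn_leaves {Q : LPath} {t : BTree} (hQ : Q.labels.Nodup)
    (ht : t ∈ labelledTrees Q.labels.length) :
    StrictMonoOn (lam Q.labels.toFinset) {a | a ∈ t.leaves} := by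
  refine (lam_strictMonoOn _).mono fun a (ha : a ∈ t.leaves) => ?_
  rw [ht.1.mem_iff, List.mem_range'_1] at ha
  rw [List.toFinset_card_of_nodup hQ]
  exact ⟨ha.1, by omega⟩

/-- The tree `t`, with labels in an arbitrary set, is coded by the path `Q`. -/
structure Codes (t : BTree) (Q : LPath) : Prop where
  normal : t.Normal
  leaves : t.leaves.Perm Q.labels
  path : treePath t = Q

theorem Codes.mem {n : ℕ} {t : BTree} {Q : LPath} (h : Codes t Q)
    (hQ : Q.labels.Perm (List.range' 1 n)) : t ∈ labelledTrees n :=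
  ⟨h.leaves.trans hQ, h.normal⟩

theorem Codes.nodup {t : BTree} {Q : LPath} (h : Codes t Q) (hQ : Q.labels.Nodup) :
    t.leaves.Nodup := h.leaves.nodup_iff.2 hQ

theorem leaves_relabel_lam {Q : LPath} {t : BTree} (hQ : Q.labels.Nodup)
    (ht : t ∈ labelledTrees Q.labels.length) :
    (t.relabel (lam Q.labels.toFinset)).leaves.Perm Q.labels := by
  refine (leaves_relabel _ _).trans ?_
  conv_rhs => rw [← map_lam_standardize Q.labels]
  exact (ht.1.trans (standardize_perm hQ).symm).map _

/-- A recursive call sees only the standardized part; this carries its result back to the actual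
labels. -/
theorem Codes.relabel {Q : LPath} {t : BTree} (hQ : Q.labels.Nodup) (h : Codes t Q.std) :
    Codes (t.relabel (lam Q.labels.toFinset)) Q := by
  have ht : t ∈ labelledTrees Q.labels.length := h.mem (standardize_perm hQ)
  have hf := lam_strictMonoOn_leaves hQ ht
  have hn := nodup_of_mem_labelledTrees ht
  exact ⟨normal_relabel hn hf.injOn, leaves_relabel_lam hQ ht, by
    rw [treePath_relabel hn hf, h.path, std_map_lam]⟩

theorem codes_leaf (a : ℕ) : Codes (leaf a) ⟨[], [a]⟩ := ⟨trivial, by simp [leaves], rfl⟩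

theorem Codes.disjoint {t u : BTree} {P Q : LPath} (ht : Codes t P) (hu : Codes u Q)
    (h : (P.labels ++ Q.labels).Nodup) : t.leaves.Disjoint u.leaves := fun _ ha hb =>
  List.disjoint_of_nodup_append h (ht.leaves.mem_iff.1 ha) (hu.leaves.mem_iff.1 hb)

theorem Codes.join {t u : BTree} {P Q : LPath} (ht : Codes t P) (hu : Codes u Q)
    (h : (P.labels ++ Q.labels).Nodup) : Codes (join t u) (P.merge Q) := by
  have hd := ht.disjoint hu h
  obtain ⟨h1, h2, -⟩ := List.nodup_append.1 h
  exact ⟨normal_join hd ht.normal hu.normal,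
    (leaves_join t u).trans ((ht.leaves.append hu.leaves).trans (labels_merge P Q).symm), by
    rw [treePath_join (ht.nodup h1) (hu.nodup h2) hd, ht.path, hu.path]⟩

theorem eq_singleton_of_length {P : LPath} (h : P.Compat) (h0 : P.steps.length = 0) :
    ∃ a, P = ⟨[], [a]⟩ := by
  have hl := h.length_labels
  rw [h0] at hl
  obtain ⟨a, ha⟩ := List.length_eq_one_iff.1 hl
  exact ⟨a, LPath.ext (List.length_eq_zero_iff.1 h0) ha⟩

/-- The map `Φ` is inverse to the coding of trees by paths. -/
theorem codes_Phi {P : LPath} (hP : P.Motzkin) (hl : P.labels.Perm (List.range' 1 P.size)) :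
    Codes (Phi P) P := by
  induction hn : P.size using Nat.strong_induction_on generalizing P with
  | _ n ih =>
    have hc := hP.compat
    have hlen : P.size = P.steps.length + 1 := hc.length_labels
    have hpos := hP.length_pos
    have hnd := nodup_of_perm_range hl
    have ih' : ∀ Q : LPath, Q.Motzkin → Q.labels.Nodup → Q.labels.length < n →
        Codes ((Phi Q.std).relabel (lam Q.labels.toFinset)) Q := fun Q hQ hQn hQl => by
      have e : Q.std.size = Q.labels.length := by simp [LPath.size, std]
      exact (ih _ hQl hQ.std (by rw [e]; exact standardize_perm hQn) e).relabel hQn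
    rw [Phi]
    split_ifs with h2 h0 hk
    -- Size two: the only step must be `-1`, which puts the labels in the order `1`, `2`.
    · obtain ⟨R, x, Q, rfl, hR, hRc, hx, hQc⟩ := hc.exists_cat hpos
      obtain ⟨a, rfl⟩ := eq_singleton_of_length hRc hR
      simp only [steps_cat, List.length_append, List.length_cons] at hlen
      obtain ⟨b, rfl⟩ := eq_singleton_of_length hQc (by omega)
      have h3 := hP.height_length
      simp only [height, steps_cat] at h3
      simp at h3
      subst h3
      simp only [StepOK, first, rev] at hx
      simp at hx
      have m1 := hl.mem_iff (a := 1)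
      have m2 := hl.mem_iff (a := 2)
      simp [size, List.mem_range'_1] at m1 m2
      obtain rfl : a = 1 := by omega
      obtain rfl : b = 2 := by omega
      exact ⟨by simp [BTree.Normal, minLeaf], by simp [leaves], by
        simp [treePath, merge, first, rev, cat]⟩
    · obtain ⟨R, x, Q, rfl, hR, hRc, hx, hQc⟩ := hc.exists_cat hpos
      obtain ⟨a, rfl⟩ := eq_singleton_of_length hRc hR
      have hx0 : x = 0 := by simpa using h0
      subst hx0
      simp only [steps_cat, List.length_append, List.length_cons] at hlen
      have hQs : Q.steps ≠ [] := by
        rintro h; simp [h] at hlen; omega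
      have s1 := suffix_cat hRc 0 Q
      have s2 := suffixLabels_cat hRc 0 Q
      simp only [List.length_nil, zero_add] at s1 s2
      rw [s1, s2]
      have hQ : Q.Motzkin := by
        refine ⟨hQc, fun j hj => ?_, ?_⟩
        · have := hP.nonneg (1 + j) (by simp; omega)
          have e := height_cat_right ⟨[], [a]⟩ 0 Q j
          simp only [List.length_nil, zero_add, height_zero] at e
          rwa [e] at this
        · have := hP.height_length
          have e := height_cat_right ⟨[], [a]⟩ 0 Q Q.steps.length
          simp only [List.length_nil, zero_add, height_zero] at e
          rw [steps_cat, List.nil_append, List.length_cons, add_comm] at this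
          rw [e] at this
          exact this
      have := (codes_leaf a).join
        (ih' Q hQ (List.nodup_append.1 hnd).2.1 (by rw [hQc.length_labels]; omega)) hnd
      simpa [merge, hQs] using this
    · obtain ⟨hk1, hk2, hk3⟩ := Nat.find_spec hk
      have hmin := fun m => Nat.find_min hk (m := m)
      generalize Nat.find hk = k at hk1 hk2 hk3 hmin
      obtain ⟨m, rfl⟩ : ∃ m, k = m + 1 := ⟨k - 1, by omega⟩
      -- The return to `0` is not at the last point, where the height is `-1`, so something remains
      -- after the cut.
      have hms : m + 1 < P.steps.length := by
        rcases Nat.lt_or_ge (m + 1) P.steps.length with h | h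
        · exact h
        · have := hP.height_length
          rw [show P.steps.length = m + 1 by omega, hk3] at this
          omega
      obtain ⟨R, x, Q, rfl, rfl, hRc, hx, hQc⟩ := hc.exists_cat (show m < P.steps.length by omega)
      have hle : ∀ j, 1 ≤ j → j ≤ R.steps.length → 1 ≤ R.height j := fun j h1 hj => by
        have e1 := hP.nonneg j (by omega)
        have e2 := hmin j (by omega)
        rw [height_cat_left _ _ _ hj] at e1 e2
        have : ¬ R.height j = 0 := fun h => e2 ⟨by omega, h1, h⟩
        omega
      rw [height_cat_succ] at hk3
      -- A first part without steps would make the first step of the path `0`, which is the previous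
      -- case.
      have hRs : 1 ≤ R.steps.length := by
        by_contra h
        have h3 : R.steps = [] := List.length_eq_zero_iff.1 (by omega)
        rw [h3] at hk3
        simp at hk3
        apply h0
        simp [h3, hk3]
      have hR1 := hle _ hRs le_rfl
      -- A step descends by at most one, so the first return comes from height exactly `1` by a step
      -- `-1`; the labels then ascend, and `merge` puts the parts in this order.
      have hx' : x = -1 ∧ R.height R.steps.length = 1 ∧ R.rev.first < Q.first := by
        unfold StepOK at hx
        omega
      obtain ⟨rfl, hR1', hlt⟩ := hx'
      have hRm : R.rev.Motzkin := Above.motzkin_rev ⟨hRc, hle⟩ hR1'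
      have hQ : Q.Motzkin := by
        simp only [steps_cat, List.length_append, List.length_cons] at *
        refine ⟨hQc, fun j hj => ?_, ?_⟩
        · have := hP.nonneg (R.steps.length + 1 + j) (by simp; omega)
          rw [height_cat_right] at this
          omega
        · have := hP.height_length
          rw [steps_cat, List.length_append, List.length_cons, add_comm Q.steps.length,
            ← add_assoc, height_cat_right] at this
          omega
      rw [suffix_cat hRc, suffixLabels_cat hRc, revPrefix_cat hRc, prefixLabels_cat hRc]
      obtain ⟨hn1, hn2, -⟩ := List.nodup_append.1 hnd
      simp only [steps_cat, List.length_append, List.length_cons] at *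
      have := (ih' R.rev hRm (by simpa using hn1)
        (by simp [hRc.length_labels]; omega)).join
        (ih' Q hQ hn2 (by simp [hQc.length_labels]; omega))
        (((List.reverse_perm R.labels).append_right Q.labels).nodup_iff.2 hnd)
      rwa [LPath.merge, if_neg (fun h => hRm.steps_ne_nil h.1),
        if_neg (fun h => hQ.steps_ne_nil h.1), if_pos hlt, rev_rev] at this
    -- The default value of `Phi` is not reached: the last step leads from a nonnegative height to
    -- `-1`, so the height before it is `0`.
    · exfalso
      apply hk
      refine ⟨P.steps.length - 1, by omega, by omega, ?_⟩
      have e := P.height_succ (j := P.steps.length - 1) (by omega)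
      have hst := hc.step (P.steps.length - 1) (by omega)
      rw [Nat.sub_add_cancel (by omega), hP.height_length] at e
      have := hP.nonneg (P.steps.length - 1) (by omega)
      unfold StepOK at hst
      omega

theorem Phi_mem {n : ℕ} {P : LPath} (h : P ∈ motzkinPaths n) : Phi P ∈ labelledTrees n := by
  obtain ⟨h1, h2⟩ := mem_motzkinPaths.1 h
  have e : P.size = n := by simpa [LPath.size] using h2.length_eq
  exact (codes_Phi h1 (e ▸ h2)).mem h2

theorem treePath_Phi {n : ℕ} {P : LPath} (h : P ∈ motzkinPaths n) : treePath (Phi P) = P := by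
  obtain ⟨h1, h2⟩ := mem_motzkinPaths.1 h
  have e : P.size = n := by simpa [LPath.size] using h2.length_eq
  exact (codes_Phi h1 (e ▸ h2)).path

theorem treePath_mem {n : ℕ} (hn : 2 ≤ n) {t : BTree} (h : t ∈ labelledTrees n) :
    treePath t ∈ motzkinPaths n := by
  have hd := nodup_of_mem_labelledTrees h
  have hl : t.leaves.length = n := by simpa using h.1.length_eq
  refine mem_motzkinPaths.2 ⟨(treeLike_treePath hd).motzkin.resolve_left fun h0 => ?_,
    (labels_treePath t).trans h.1⟩
  have := length_steps_treePath hd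
  simp [h0] at this
  omega

/-- `treePath` is a left inverse of `Phi`. It is also injective, and `t` and `Phi (treePath t)` have
the same path, which gives surjectivity. -/
theorem bijOn_Phi {n : ℕ} (hn : 2 ≤ n) : Set.BijOn Phi (motzkinPaths n) (labelledTrees n) := by
  refine Set.BijOn.mk (fun P hP => Phi_mem hP) (fun P hP Q hQ e => ?_) fun t ht => ?_
  · rw [← treePath_Phi hP, e, treePath_Phi hQ]
  · have hP := treePath_mem hn ht
    have hm := Phi_mem hP
    exact ⟨_, hP, treePath_inj hm.2 ht.2 (nodup_of_mem_labelledTrees hm)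
      (nodup_of_mem_labelledTrees ht) (treePath_Phi hP)⟩

end WellLabelled

/-! ### The map `Φ'` as the inverse of the coding of marked trees. -/

namespace WellLabelled
open BTree LPath

/-- Needed when the cut is at the end of a positive path: there `PhiMarked` applies `Phi` without
relabelling the result. -/
theorem standardize_eq_self {n : ℕ} {w : List ℕ} (h : w.Perm (List.range' 1 n)) :
    standardize w = w := by
  unfold standardize
  conv_rhs => rw [← List.map_id w]
  refine List.map_congr_left fun x hx => ?_
  have hx' := h.mem_iff.1 hx
  rw [List.mem_range'_1] at hx'
  have e : (Finset.range x).filter (fun y => y ∈ w.toFinset) = Finset.Ico 1 x := by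
    ext y
    simp only [Finset.mem_filter, Finset.mem_range, List.mem_toFinset, h.mem_iff,
      List.mem_range'_1, Finset.mem_Ico]
    omega
  rw [lamInv, Nat.count_eq_card_filter_range, e, Nat.card_Ico, id]
  omega

theorem std_eq_self {n : ℕ} {P : LPath} (h : P.labels.Perm (List.range' 1 n)) : P.std = P :=
  LPath.ext rfl (standardize_eq_self h)

/-- The tree `t` marked at `v`, with labels in an arbitrary set, is coded by the path `Q`. -/
structure CodesMarked (t v : BTree) (Q : LPath) : Prop where
  normal : t.Normal
  leaves : t.leaves.Perm Q.labels
  mem : v ∈ t.vertices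
  path : markedPath v t = Q

theorem CodesMarked.mem_markedTrees {n : ℕ} {t v : BTree} {Q : LPath} (h : CodesMarked t v Q)
    (hQ : Q.labels.Perm (List.range' 1 n)) : (t, v) ∈ markedTrees n :=
  ⟨⟨h.leaves.trans hQ, h.normal⟩, h.mem⟩

theorem CodesMarked.relabel {Q : LPath} {t v : BTree} (hQ : Q.labels.Nodup)
    (h : CodesMarked t v Q.std) :
    CodesMarked (t.relabel (lam Q.labels.toFinset)) (v.relabel (lam Q.labels.toFinset)) Q := by
  have ht : t ∈ labelledTrees Q.labels.length := (h.mem_markedTrees (standardize_perm hQ)).1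
  have hf := lam_strictMonoOn_leaves hQ ht
  have hn := nodup_of_mem_labelledTrees ht
  exact ⟨normal_relabel hn hf.injOn, leaves_relabel_lam hQ ht, relabel_mem_vertices _ h.mem, by
    rw [markedPath_relabel h.normal hn h.mem hf, h.path, std_map_lam]⟩

theorem Codes.markedRoot {t : BTree} {P : LPath} (h : Codes t P.rev) (hP : P.labels.Nodup) :
    CodesMarked t t P := by
  have hp := List.reverse_perm P.labels
  refine ⟨h.normal, h.leaves.trans hp, self_mem_vertices t, ?_⟩
  rw [markedPath_self (h.nodup (hp.nodup_iff.2 hP)), h.path, rev_rev]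

theorem Codes.joinMarked {t u v : BTree} {P Q : LPath} (ht : Codes t P) (hu : CodesMarked u v Q)
    (h : (P.labels ++ Q.labels).Nodup) : CodesMarked (BTree.join t u) v (P.mergeMarked Q) := by
  have hd : t.leaves.Disjoint u.leaves := fun _ ha hb =>
    List.disjoint_of_nodup_append h (ht.leaves.mem_iff.1 ha) (hu.leaves.mem_iff.1 hb)
  refine ⟨normal_join hd ht.normal hu.normal, (leaves_join t u).trans
    ((ht.leaves.append hu.leaves).trans (labels_mergeMarked P Q).symm), mem_join_right hu.mem, ?_⟩
  rw [markedPath_join hu.mem hd, ht.path, hu.path]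

theorem Motzkin.codes_relabel_Phi {Q : LPath} (hQ : Q.Motzkin) (hn : Q.labels.Nodup) :
    Codes ((Phi Q.std).relabel (lam Q.labels.toFinset)) Q := by
  have e : Q.std.size = Q.labels.length := by simp [LPath.size, std]
  exact (codes_Phi hQ.std (by rw [e]; exact standardize_perm hn)).relabel hn

/-- The heights of a positive path after its last cut, when the cut is followed by an up step. -/
theorem two_le_height {P : LPath} (hc : P.Compat) {m : ℕ}
    (hR : ∀ j, 1 ≤ j → j ≤ m → 1 ≤ P.height j) (h2 : P.height (m + 1) = 2)
    (hgr : ∀ k, m + 1 < k → k ≤ P.size → ¬ P.IsCut k) (j : ℕ) (hj : m + 1 + j ≤ P.steps.length) :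
    2 ≤ P.height (m + 1 + j) := by
  have hlen : P.size = P.steps.length + 1 := hc.length_labels
  induction j using Nat.strong_induction_on with
  | _ j ih =>
    rcases Nat.eq_zero_or_pos j with rfl | hpos
    · exact h2.ge
    · obtain ⟨i, rfl⟩ : ∃ i, j = i + 1 := ⟨j - 1, by omega⟩
      have e1 := ih i (by omega) (by omega)
      have e2 := P.height_succ (j := m + 1 + i) (by omega)
      have e3 := hc.step (m + 1 + i) (by omega)
      by_contra hlt
      rw [← add_assoc] at hlt
      -- A first descent below `2` would reach exactly `1` with all earlier heights at least `1`,
      -- hence give a later cut. The cut number is one more than the number of steps.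
      refine hgr (m + 1 + i + 1 + 1) (by omega) (by omega) ⟨fun a ha => ?_, ?_⟩
      · rw [Finset.mem_Icc] at ha
        rcases Nat.lt_or_ge m (a - 1) with h | h
        · have := ih (a - 1 - (m + 1)) (by omega) (by omega)
          rw [show m + 1 + (a - 1 - (m + 1)) = a - 1 by omega] at this
          omega
        · exact hR _ (by omega) h
      · rw [Nat.add_sub_cancel]
        unfold StepOK at e3
        omega

/-- The map `Φ'` is inverse to the coding of marked trees by paths. -/
theorem codesMarked_PhiMarked {P : LPath} (hP : P.Positive)
    (hl : P.labels.Perm (List.range' 1 P.size)) :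
    CodesMarked (PhiMarked P).1 (PhiMarked P).2 P := by
  induction hn : P.size using Nat.strong_induction_on generalizing P with
  | _ n ih =>
    have hc := hP.compat
    have hlen : P.size = P.steps.length + 1 := hc.length_labels
    have hnd := nodup_of_perm_range hl
    have ih' : ∀ Q : LPath, Q.Positive → Q.labels.Nodup → Q.labels.length < n →
        CodesMarked ((PhiMarked Q.std).1.relabel (lam Q.labels.toFinset))
          ((PhiMarked Q.std).2.relabel (lam Q.labels.toFinset)) Q := fun Q hQ hQn hQl => by
      have e : Q.std.size = Q.labels.length := by simp [LPath.size, std]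
      exact (ih _ hQl hQ.std (by rw [e]; exact standardize_perm hQn) e).relabel hQn
    rw [PhiMarked]
    split_ifs with h2 h0 hk
    · obtain ⟨a, rfl⟩ := eq_singleton_of_length hc (by omega)
      have m1 := hl.mem_iff (a := 1)
      simp [size] at m1
      subst m1
      exact ⟨trivial, by simp [leaves], by simp, by simp [markedPath]⟩
    · obtain ⟨R, x, Q, rfl, hR, hRc, hx, hQc⟩ := hc.exists_cat (show 0 < P.steps.length by omega)
      obtain ⟨a, rfl⟩ := eq_singleton_of_length hRc hR
      have hx0 : x = 0 := by simpa using h0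
      subst hx0
      simp only [steps_cat, List.length_append, List.length_cons] at hlen
      have s1 := suffix_cat hRc 0 Q
      have s2 := suffixLabels_cat hRc 0 Q
      simp only [List.length_nil, zero_add] at s1 s2
      simp only [s1, s2]
      have hQ : Q.Positive := by
        refine ⟨hQc, fun j hj => ?_⟩
        have := hP.nonneg (1 + j) (by simp; omega)
        have e := height_cat_right ⟨[], [a]⟩ 0 Q j
        simp only [List.length_nil, zero_add, height_zero] at e
        rwa [e] at this
      have := (codes_leaf a).joinMarked
        (ih' Q hQ (List.nodup_append.1 hnd).2.1 (by rw [hQc.length_labels]; omega)) hnd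
      simpa [mergeMarked, rev] using this
    · obtain ⟨hk1, hk2⟩ := hk
      have hcut : P.IsCut P.lastCut := Nat.findGreatest_of_ne_zero rfl (by omega)
      have hgr : ∀ k, P.lastCut < k → k ≤ P.size → ¬ P.IsCut k := fun k h1 h2 =>
        Nat.findGreatest_is_greatest h1 h2
      dsimp only
      generalize P.lastCut = k at hk1 hk2 hcut hgr ⊢
      obtain ⟨m, rfl⟩ : ∃ m, k = m + 1 := ⟨k - 1, by omega⟩
      obtain ⟨hcut1, hcut2⟩ := hcut
      rw [Nat.add_sub_cancel] at hcut1 hcut2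
      have hm : 1 ≤ m := by
        rcases Nat.eq_zero_or_pos m with rfl | h
        · simp at hcut2
        · exact h
      have hle : ∀ j, 1 ≤ j → j ≤ m → 1 ≤ P.height j := fun j h1 hj => by
        rcases hj.eq_or_lt with rfl | h
        · exact hcut2.ge
        · simpa using hcut1 (j + 1) (by rw [Finset.mem_Icc]; omega)
      have h2le := two_le_height hc hle
      obtain ⟨R, x, Q, rfl, rfl, hRc, hx, hQc⟩ := hc.exists_cat (show m < P.steps.length by omega)
      have hR1 : R.height R.steps.length = 1 := by rwa [height_cat_left _ _ _ le_rfl] at hcut2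
      have hRa : R.Above := ⟨hRc, fun j h1 hj => by
        have := hle j h1 hj
        rwa [height_cat_left _ _ _ hj] at this⟩
      have hRs : R.rev.steps ≠ [] := fun h => by
        have := congrArg List.length h
        simp at this
        rw [this] at hm
        simp at hm
      -- A step `0` after the cut would keep the height at `1` and move the last cut one point
      -- further.
      have hx0 : x ≠ 0 := by
        rintro rfl
        refine hgr (R.steps.length + 1 + 1) (by omega) (by omega) ⟨fun j hj => ?_, ?_⟩
        · rw [Finset.mem_Icc] at hj
          exact hle _ (by omega) (by omega)
        · rw [Nat.add_sub_cancel, height_cat_succ, hR1]; simp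
      have hQ : Q.Positive := by
        refine ⟨hQc, fun j hj => ?_⟩
        have hj' : R.steps.length + 1 + j ≤ (R.cat x Q).steps.length := by simp; omega
        have e1 := hP.nonneg (R.steps.length + 1 + j) hj'
        rw [height_cat_right, hR1] at e1
        -- After a down step the second part starts at height `0`, and positivity of the whole path
        -- suffices. After an up step it starts at height `2`, and maximality of the cut keeps it
        -- there or higher.
        rcases hx with ⟨rfl, -⟩ | h | ⟨rfl, -⟩
        · omega
        · exact absurd h hx0
        · have := h2le (by rw [height_cat_succ, hR1]; norm_num) hgr j hj'
          rw [height_cat_right, hR1] at this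
          omega
      rw [suffix_cat hRc, suffixLabels_cat hRc, revPrefix_cat hRc, prefixLabels_cat hRc]
      obtain ⟨hn1, hn2, -⟩ := List.nodup_append.1 hnd
      have := (Motzkin.codes_relabel_Phi (hRa.motzkin_rev hR1) (by simpa using hn1)).joinMarked
        (ih' Q hQ hn2 (by
          simp only [steps_cat, List.length_append, List.length_cons] at hlen
          rw [hQc.length_labels]; omega))
        (((List.reverse_perm R.labels).append_right Q.labels).nodup_iff.2 hnd)
      have ex : (if R.rev.steps = [] then 0 else if R.rev.first < Q.first then -1 else 1) = x := by
        rw [if_neg hRs]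
        unfold StepOK at hx
        split_ifs <;> omega
      rwa [mergeMarked, rev_rev, ex] at this
    · have hs1 : 0 < P.steps.length := by omega
      have e := P.height_succ hs1
      have hst := hc.step 0 hs1
      have hp := hP.nonneg 1 hs1
      have h1 : P.height 1 = 1 := by
        have : P.steps.getD 0 0 ≠ 0 := fun h => h0 (by
          rw [List.getD_eq_getElem _ _ hs1] at h
          rw [List.head?_eq_getElem?, List.getElem?_eq_getElem hs1, h])
        unfold StepOK at hst
        simp only [height_zero, zero_add] at e
        omega
      -- The first step is up, so `2` is a cut, its condition on `j` being empty. Thus `lastCut` is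
      -- not the default `0`, and in this branch it is the size of the path.
      have h2 : 2 ≤ P.lastCut := Nat.le_findGreatest (by omega) ⟨fun j hj => by simp at hj, h1⟩
      have hle : P.lastCut ≤ P.size := Nat.findGreatest_le _
      have hcut : P.IsCut P.lastCut := Nat.findGreatest_of_ne_zero rfl (by omega)
      rw [show P.lastCut = P.steps.length + 1 by omega] at hcut
      obtain ⟨hcut1, hcut2⟩ := hcut
      rw [Nat.add_sub_cancel] at hcut1 hcut2
      have hA : P.Above := ⟨hc, fun j h1 hj => by
        rcases hj.eq_or_lt with rfl | h
        · exact hcut2.ge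
        · simpa using hcut1 (j + 1) (by rw [Finset.mem_Icc]; omega)⟩
      have hrl : P.rev.labels.Perm (List.range' 1 P.size) := (List.reverse_perm _).trans hl
      rw [revPrefix_size hc, std_eq_self hrl]
      refine (codes_Phi (hA.motzkin_rev hcut2) ?_).markedRoot hnd
      simpa [LPath.size] using hrl

theorem PhiMarked_spec {n : ℕ} {P : LPath} (h : P ∈ positivePaths n) :
    PhiMarked P ∈ markedTrees n ∧ markedPath (PhiMarked P).2 (PhiMarked P).1 = P := by
  obtain ⟨h1, h2⟩ := mem_positivePaths.1 h
  have e : P.size = n := by simpa [LPath.size] using h2.length_eq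
  have := codesMarked_PhiMarked h1 (e ▸ h2)
  exact ⟨this.mem_markedTrees h2, this.path⟩

theorem markedPath_mem {n : ℕ} {m : BTree × BTree} (h : m ∈ markedTrees n) :
    markedPath m.2 m.1 ∈ positivePaths n :=
  mem_positivePaths.2 ⟨positive_markedPath h.1.2 (nodup_of_mem_labelledTrees h.1) h.2,
    (labels_markedPath m.2 m.1).trans h.1.1⟩

theorem bijOn_PhiMarked (n : ℕ) : Set.BijOn PhiMarked (positivePaths n) (markedTrees n) := by
  refine Set.BijOn.mk (fun P hP => (PhiMarked_spec hP).1) (fun P hP Q hQ e => ?_) fun m hm => ?_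
  · rw [← (PhiMarked_spec hP).2, e, (PhiMarked_spec hQ).2]
  · have hP := markedPath_mem hm
    obtain ⟨h1, h2⟩ := PhiMarked_spec hP
    obtain ⟨e1, e2⟩ := markedPath_inj h1.1.2 hm.1.2 (nodup_of_mem_labelledTrees h1.1)
      (nodup_of_mem_labelledTrees hm.1) h1.2 hm.2 h2
    exact ⟨_, hP, Prod.ext e1 e2⟩

end WellLabelled

namespace WellLabelled
open BTree

/-! ### Parents and siblings -/

namespace BTree

theorem card_vertices {t : BTree} (h : t.leaves.Nodup) :
    t.vertices.card + 1 = 2 * t.leaves.length := by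
  induction t with
  | leaf a => simp [vertices, leaves]
  | node l r hl hr =>
    obtain ⟨hl', hr', -⟩ := List.nodup_append.1 h
    have hd := disjoint_of_nodup h
    have h1 : Disjoint l.vertices r.vertices := Finset.disjoint_left.2 fun v hv hv' =>
      not_mem_vertices_of_disjoint hd hv' hv
    have h2 : node l r ∉ l.vertices ∪ r.vertices := by
      intro hm
      have := l.length_leaves_pos
      have := r.length_leaves_pos
      rcases Finset.mem_union.1 hm with h | h <;>
        · have := length_leaves_le h
          simp only [leaves, List.length_append] at this
          omega
    rw [vertices, Finset.card_insert_of_notMem h2, Finset.card_union_of_disjoint h1]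
    simp only [leaves, List.length_append]
    have := hl hl'
    have := hr hr'
    omega

/-- The vertices `v` and `w` are the two children of a vertex of `t`. -/
def Sib (t v w : BTree) : Prop := node v w ∈ t.vertices ∨ node w v ∈ t.vertices

theorem Sib.symm {t v w : BTree} (h : Sib t v w) : Sib t w v := Or.symm h

theorem Sib.left {t v w : BTree} (h : Sib t v w) : v ∈ t.vertices := by
  rcases h with h | h
  · exact left_mem h
  · exact right_mem h

theorem exists_sib {t v : BTree} (hv : v ∈ t.vertices) (hne : v ≠ t) : ∃ w, Sib t v w := by
  induction t with
  | leaf a => simp_all [vertices]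
  | node l r hl hr =>
    rcases mem_vertices_node.1 hv with h | h | h
    · exact absurd h hne
    · by_cases e : v = l
      · subst e; exact ⟨r, Or.inl (self_mem_vertices _)⟩
      · obtain ⟨w, hw⟩ := hl h e
        refine ⟨w, hw.imp (fun h => ?_) fun h => ?_⟩ <;> simp [mem_vertices_node, h]
    · by_cases e : v = r
      · subst e; exact ⟨l, Or.inr (self_mem_vertices _)⟩
      · obtain ⟨w, hw⟩ := hr h e
        refine ⟨w, hw.imp (fun h => ?_) fun h => ?_⟩ <;> simp [mem_vertices_node, h]

theorem child_length_lt {v a b : BTree} (h : v = a ∨ v = b) :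
    v.leaves.length < (node a b).leaves.length := by
  have := a.length_leaves_pos
  have := b.length_leaves_pos
  simp only [leaves, List.length_append]
  rcases h with rfl | rfl <;> omega

theorem child_mem {v a b t : BTree} (h : v = a ∨ v = b) (ht : node a b ∈ t.vertices) :
    v ∈ t.vertices := by
  rcases h with rfl | rfl
  · exact left_mem ht
  · exact right_mem ht

theorem child_ne_root {v a b t : BTree} (h : v = a ∨ v = b) (ht : node a b ∈ t.vertices) :
    v ≠ t := by
  rintro rfl
  have := child_length_lt h
  have := length_leaves_le ht
  omega

/-- A child of the root cannot also be a child of a lower vertex: on its own side it would be too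
large, and on the other side it would share no leaf label. Below the root, induction applies on the
side containing `v`. -/
theorem parent_unique {t v a b c d : BTree} (h : t.leaves.Nodup) (h1 : node a b ∈ t.vertices)
    (h2 : node c d ∈ t.vertices) (hv1 : v = a ∨ v = b) (hv2 : v = c ∨ v = d) :
    node a b = node c d := by
  induction t with
  | leaf a => simp [vertices] at h1
  | node l r hl hr =>
    obtain ⟨hl', hr', -⟩ := List.nodup_append.1 h
    have hd := disjoint_of_nodup h
    have key : ∀ {c d : BTree}, (v = c ∨ v = d) → (v = l ∨ v = r) →
        node c d ∈ l.vertices ∨ node c d ∈ r.vertices → False := by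
      intro c d hv hlr hm
      have := child_length_lt hv
      rcases hm with hm | hm <;> rcases hlr with rfl | rfl
      · have := length_leaves_le hm; omega
      · exact not_mem_vertices_of_disjoint hd (self_mem_vertices _) (child_mem hv hm)
      · exact not_mem_vertices_of_disjoint hd (child_mem hv hm) (self_mem_vertices _)
      · have := length_leaves_le hm; omega
    rcases mem_vertices_node.1 h1 with e1 | h1' | h1' <;>
      rcases mem_vertices_node.1 h2 with e2 | h2' | h2'
    · rw [e1, e2]
    · obtain ⟨rfl, rfl⟩ := node.inj e1; exact (key hv2 hv1 (Or.inl h2')).elim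
    · obtain ⟨rfl, rfl⟩ := node.inj e1; exact (key hv2 hv1 (Or.inr h2')).elim
    · obtain ⟨rfl, rfl⟩ := node.inj e2; exact (key hv1 hv2 (Or.inl h1')).elim
    · exact hl hl' h1' h2'
    · exact (not_mem_vertices_of_disjoint hd (child_mem hv2 h2') (child_mem hv1 h1')).elim
    · obtain ⟨rfl, rfl⟩ := node.inj e2; exact (key hv1 hv2 (Or.inr h1')).elim
    · exact (not_mem_vertices_of_disjoint hd (child_mem hv1 h1') (child_mem hv2 h2')).elim
    · exact hr hr' h1' h2'

theorem left_ne_right {l r t : BTree} (h : t.leaves.Nodup) (hm : node l r ∈ t.vertices) :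
    l ≠ r := by
  rintro rfl
  exact not_mem_vertices_of_disjoint (disjoint_of_nodup (nodup_of_mem h hm))
    (self_mem_vertices l) (self_mem_vertices l)

theorem Sib.ne {t v w : BTree} (h : t.leaves.Nodup) (hs : Sib t v w) : v ≠ w := by
  rcases hs with hs | hs
  · exact left_ne_right h hs
  · exact (left_ne_right h hs).symm

theorem Sib.unique {t v w w' : BTree} (h : t.leaves.Nodup) (h1 : Sib t v w) (h2 : Sib t v w') :
    w = w' := by
  rcases h1 with h1 | h1 <;> rcases h2 with h2 | h2
  · exact (node.inj (parent_unique h h1 h2 (Or.inl rfl) (Or.inl rfl))).2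
  · have e := node.inj (parent_unique h h1 h2 (Or.inl rfl) (Or.inr rfl))
    exact e.2.trans (e.1 ▸ rfl)
  · have e := node.inj (parent_unique h h1 h2 (Or.inr rfl) (Or.inl rfl))
    exact e.1.trans (e.2 ▸ rfl)
  · exact (node.inj (parent_unique h h1 h2 (Or.inr rfl) (Or.inr rfl))).1

theorem Sib.ne_root {t v w : BTree} (h : Sib t v w) : v ≠ t := by
  rcases h with h | h
  · exact child_ne_root (Or.inl rfl) h
  · exact child_ne_root (Or.inr rfl) h

theorem leaf_mem_vertices {a : ℕ} {t : BTree} (h : a ∈ t.leaves) : leaf a ∈ t.vertices := by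
  induction t with
  | leaf b => simp_all [vertices, leaves]
  | node l r hl hr =>
    rcases List.mem_append.1 h with h | h
    · exact mem_vertices_node.2 (Or.inr (Or.inl (hl h)))
    · exact mem_vertices_node.2 (Or.inr (Or.inr (hr h)))

end BTree

/-! ### The labelling procedure -/

/-- What holds when the labels up to `m` have been attributed. -/
structure LabelInv (t : BTree) (m : ℕ) (lab : BTree → Option ℕ) : Prop where
  leaf : ∀ a, lab (leaf a) = some a
  root : lab t = none
  bound : ∀ v ∈ t.vertices, ∀ c, lab v = some c → 1 ≤ c ∧ c ≤ m
  inj : ∀ v ∈ t.vertices, ∀ w ∈ t.vertices, ∀ c, lab v = some c → lab w = some c → v = w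
  surj : ∀ c, 1 ≤ c → c ≤ m → ∃ v ∈ t.vertices, lab v = some c
  child : ∀ l r, node l r ∈ t.vertices → ∀ c, lab (node l r) = some c →
    ∃ i j, lab l = some i ∧ lab r = some j ∧ i < c ∧ j < c
  -- Greediness: when `c` is attributed, a non-root vertex with no label below `c` and both children
  -- labelled below `c` is a competitor.
  min : ∀ l r, node l r ∈ t.vertices → ∀ c i j, lab (node l r) = some c → lab l = some i →
    lab r = some j → ∀ l' r', node l' r' ∈ t.vertices → node l' r' ≠ t →
    (∀ d, lab (node l' r') = some d → c ≤ d) → ∀ i' j', lab l' = some i' → lab r' = some j' →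
    i' < c → j' < c → min i j ≤ min i' j'

theorem labelInv_leafLabel {n : ℕ} (hn : 2 ≤ n) {t : BTree} (ht : t ∈ labelledTrees n) :
    LabelInv t n leafLabel := by
  have hl : t.leaves.length = n := by simpa using ht.1.length_eq
  constructor
  · intro a; rfl
  · cases t with
    | leaf a => simp [leaves] at hl; omega
    | node l r => rfl
  · intro v hv c hc
    cases v with
    | node l r => simp [leafLabel] at hc
    | leaf a =>
      simp only [leafLabel, Option.some.injEq] at hc
      have := leaves_subset hv (by simp [leaves] : a ∈ (leaf a).leaves)
      rw [ht.1.mem_iff, List.mem_range'_1] at this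
      omega
  · intro v _ w _ c hv hw
    cases v <;> cases w <;> simp_all [leafLabel]
  · intro c h1 h2
    exact ⟨leaf c, leaf_mem_vertices (by rw [ht.1.mem_iff, List.mem_range'_1]; omega), rfl⟩
  · intro l r _ c h
    simp [leafLabel] at h
  · intro l r _ c _ _ h
    simp [leafLabel] at h

theorem childrenLabelled_iff {lab : BTree → Option ℕ} {l r : BTree} :
    ChildrenLabelled lab (node l r) ↔ ∃ i j, lab l = some i ∧ lab r = some j := by
  simp [ChildrenLabelled, Option.isSome_iff_exists]

/-- As long as some vertex other than the root is unlabelled, there is a next one to label. -/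
theorem exists_isNext {t : BTree} {m : ℕ} {lab : BTree → Option ℕ} (h : LabelInv t m lab)
    (hu : ∃ v ∈ t.vertices, v ≠ t ∧ lab v = none) : ∃ v, IsNext t lab v := by
  classical
  have h1 : ∃ v, v ∈ t.vertices ∧ v ≠ t ∧ lab v = none ∧ ChildrenLabelled lab v := by
    obtain ⟨v, hv⟩ := hu
    induction hs : v.leaves.length using Nat.strong_induction_on generalizing v with
    | _ s ih =>
      obtain ⟨hv, hvt, hn⟩ := hv
      cases v with
      | leaf a => rw [h.leaf] at hn; cases hn
      | node l r =>
        by_cases hl : lab l = none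
        · exact ih _ (hs ▸ child_length_lt (Or.inl rfl)) l
            ⟨left_mem hv, child_ne_root (Or.inl rfl) hv, hl⟩ rfl
        by_cases hr : lab r = none
        · exact ih _ (hs ▸ child_length_lt (Or.inr rfl)) r
            ⟨right_mem hv, child_ne_root (Or.inr rfl) hv, hr⟩ rfl
        exact ⟨_, hv, hvt, hn, Option.isSome_iff_ne_none.2 hl, Option.isSome_iff_ne_none.2 hr⟩
  let S := t.vertices.filter fun v => v ≠ t ∧ lab v = none ∧ ChildrenLabelled lab v
  have hS : S.Nonempty := by
    obtain ⟨v, hv⟩ := h1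
    exact ⟨v, by simpa [S] using hv⟩
  obtain ⟨v, hv, hmin⟩ := S.exists_min_image (childMin lab) hS
  simp only [S, Finset.mem_filter] at hv hmin
  exact ⟨v, hv, fun w h1 h2 h3 h4 => hmin w ⟨h1, h2, h3, h4⟩⟩

/-- The new label exceeds all the others, so comparisons at earlier labels involve only labels that
have not changed, and the only new comparison is the minimality in `IsNext`. -/
theorem LabelInv.step {t : BTree} {m : ℕ} {lab : BTree → Option ℕ} (h : LabelInv t m lab)
    (hu : ∃ v ∈ t.vertices, v ≠ t ∧ lab v = none) :
    LabelInv t (m + 1) (labelStep t lab (m + 1)) := by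
  classical
  have hex := exists_isNext h hu
  rw [labelStep, dif_pos hex]
  have hv := hex.choose_spec
  generalize hex.choose = v at hv
  obtain ⟨⟨hvm, hvt, hvn, hvc⟩, hmin⟩ := hv
  cases v with
  | leaf a => exact hvc.elim
  | node l r =>
  obtain ⟨i, j, hi, hj⟩ := childrenLabelled_iff.1 hvc
  have hib := h.bound l (left_mem hvm) i hi
  have hjb := h.bound r (right_mem hvm) j hj
  have upd : ∀ w c, Function.update lab (node l r) (some (m + 1)) w = some c ↔
      (w = node l r ∧ c = m + 1) ∨ (w ≠ node l r ∧ lab w = some c) := by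
    intro w c
    rw [Function.update_apply]
    split_ifs with e <;> simp [e, eq_comm]
  have old : ∀ w c, lab w = some c → w ≠ node l r := by
    rintro w c hw rfl
    rw [hvn] at hw; cases hw
  have updl : ∀ w c, lab w = some c →
      Function.update lab (node l r) (some (m + 1)) w = some c := fun w c hw =>
    (upd w c).2 (Or.inr ⟨old w c hw, hw⟩)
  have lts : ∀ w c, Function.update lab (node l r) (some (m + 1)) w = some c → c < m + 1 →
      lab w = some c := fun w c hw hc => by
    rcases (upd w c).1 hw with ⟨-, e⟩ | ⟨-, e⟩
    · omega
    · exact e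
  constructor
  · intro a
    exact updl _ _ (h.leaf a)
  · rw [Function.update_apply, if_neg hvt.symm, h.root]
  · intro w hw c hc
    rcases (upd w c).1 hc with ⟨-, e⟩ | ⟨-, e⟩
    · omega
    · have := h.bound w hw c e; omega
  · intro w hw w' hw' c hc hc'
    rcases (upd w c).1 hc with ⟨e1, e⟩ | ⟨-, e⟩ <;> rcases (upd w' c).1 hc' with ⟨e1', e'⟩ | ⟨-, e'⟩
    · rw [e1, e1']
    · have := h.bound w' hw' c e'; omega
    · have := h.bound w hw c e; omega
    · exact h.inj w hw w' hw' c e e'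
  · intro c h1 h2
    rcases Nat.lt_or_ge m c with h3 | h3
    · exact ⟨_, hvm, (upd _ _).2 (Or.inl ⟨rfl, by omega⟩)⟩
    · obtain ⟨w, hw, e⟩ := h.surj c h1 h3
      exact ⟨w, hw, updl _ _ e⟩
  · intro a b hab c hc
    rcases (upd _ c).1 hc with ⟨e1, e⟩ | ⟨-, e⟩
    · obtain ⟨rfl, rfl⟩ := node.inj e1
      exact ⟨i, j, updl _ _ hi, updl _ _ hj, by omega, by omega⟩
    · obtain ⟨i', j', h1, h2, h3, h4⟩ := h.child a b hab c e
      exact ⟨i', j', updl _ _ h1, updl _ _ h2, h3, h4⟩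
  · intro a b hab c x y hc hx hy a' b' hab' hne hd x' y' hx' hy' hlx hly
    have hcm : c ≤ m + 1 := by
      rcases (upd _ c).1 hc with ⟨-, e⟩ | ⟨-, e⟩
      · omega
      · have := h.bound _ hab c e; omega
    have hx'' := lts _ _ hx' (by omega)
    have hy'' := lts _ _ hy' (by omega)
    rcases (upd _ c).1 hc with ⟨e1, rfl⟩ | ⟨-, e⟩
    · obtain ⟨rfl, rfl⟩ := node.inj e1
      have ex : x = i := Option.some.inj (hx.symm.trans (updl _ _ hi))
      have ey : y = j := Option.some.inj (hy.symm.trans (updl _ _ hj))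
      subst ex ey
      by_cases en : node a' b' = node a b
      · obtain ⟨rfl, rfl⟩ := node.inj en
        rw [hi] at hx''
        rw [hj] at hy''
        simp_all
      -- A competitor distinct from the new vertex was unlabelled before: an earlier label would be
      -- at most `m`, less than the new one.
      · have hnone : lab (node a' b') = none := by
          rw [Option.eq_none_iff_forall_not_mem]
          intro d hd'
          have := hd d (updl _ _ hd')
          have := h.bound _ hab' d hd'
          omega
        have := hmin _ hab' hne hnone (childrenLabelled_iff.2 ⟨_, _, hx'', hy''⟩)
        simpa [childMin, hi, hj, hx'', hy''] using this
    · obtain ⟨x1, y1, h1, h2, h3, h4⟩ := h.child a b hab c e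
      have ex : x = x1 := Option.some.inj (hx.symm.trans (updl _ _ h1))
      have ey : y = y1 := Option.some.inj (hy.symm.trans (updl _ _ h2))
      subst ex ey
      exact h.min a b hab c x y e h1 h2 a' b' hab' hne (fun d hd' => hd d (updl _ _ hd')) x' y'
        hx'' hy'' hlx hly

/-- Otherwise the `2n - 2` vertices other than the root would have distinct labels among fewer than
`2n - 2` values. -/
theorem LabelInv.exists_none {t : BTree} {n m : ℕ} {lab : BTree → Option ℕ}
    (h : LabelInv t m lab) (ht : t ∈ labelledTrees n) (hm : m + 2 < 2 * n) :
    ∃ v ∈ t.vertices, v ≠ t ∧ lab v = none := by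
  by_contra! hc
  have hcard := card_vertices (nodup_of_mem_labelledTrees ht)
  have hl : t.leaves.length = n := by simpa using ht.1.length_eq
  have hinj : Set.InjOn (fun v => (lab v).getD 0) (t.vertices.erase t : Finset BTree) := by
    intro v hv w hw e
    rw [Finset.mem_coe, Finset.mem_erase] at hv hw
    obtain ⟨c, hc1⟩ := Option.ne_none_iff_exists'.1 (hc v hv.2 hv.1)
    obtain ⟨d, hd1⟩ := Option.ne_none_iff_exists'.1 (hc w hw.2 hw.1)
    simp only [hc1, hd1, Option.getD_some] at e
    subst e
    exact h.inj v hv.2 w hw.2 c hc1 hd1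
  have hmaps : ∀ v ∈ t.vertices.erase t, (lab v).getD 0 ∈ Finset.Icc 1 m := by
    intro v hv
    rw [Finset.mem_erase] at hv
    obtain ⟨c, hc1⟩ := Option.ne_none_iff_exists'.1 (hc v hv.2 hv.1)
    have := h.bound v hv.2 c hc1
    simpa [hc1] using this
  have := Finset.card_le_card_of_injOn _ hmaps hinj
  rw [Finset.card_erase_of_mem (self_mem_vertices t), Nat.card_Icc] at this
  omega

theorem labelInv_foldl {n : ℕ} (hn : 2 ≤ n) {t : BTree} (ht : t ∈ labelledTrees n) {k : ℕ}
    (hk : k + 2 ≤ n) :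
    LabelInv t (n + k) ((List.range' (n + 1) k).foldl (labelStep t) leafLabel) := by
  induction k with
  | zero => exact labelInv_leafLabel hn ht
  | succ k ih =>
    have := ih (by omega)
    rw [List.range'_concat, List.foldl_append]
    simp only [List.foldl_cons, List.foldl_nil, one_mul]
    have h := this.step (this.exists_none ht (by omega))
    rwa [show n + 1 + k = n + k + 1 by omega]

/-- The labelling of all vertices of a tree with `n` leaves, the root receiving the
label `2 n - 1`. -/
noncomputable def fullLabel (n : ℕ) (t v : BTree) : ℕ := (vertexLabel n t v).getD (2 * n - 1)

/-- The properties that characterize the labelling of the vertices. -/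
structure GoodLabel (n : ℕ) (t : BTree) (L : BTree → ℕ) : Prop where
  leaf : ∀ a, L (leaf a) = a
  root : L t = 2 * n - 1
  bound : ∀ v ∈ t.vertices, 1 ≤ L v ∧ L v ≤ 2 * n - 1
  inj : Set.InjOn L t.vertices
  surj : ∀ c, 1 ≤ c → c ≤ 2 * n - 1 → ∃ v ∈ t.vertices, L v = c
  child : ∀ l r, node l r ∈ t.vertices → L l < L (node l r) ∧ L r < L (node l r)
  min : ∀ l r, node l r ∈ t.vertices → ∀ l' r', node l' r' ∈ t.vertices →
    L (node l r) ≤ L (node l' r') → L l' < L (node l r) → L r' < L (node l r) →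
    min (L l) (L r) ≤ min (L l') (L r')

theorem eq_leaf_of_mem_labelledTrees_one {t : BTree} (h : t ∈ labelledTrees 1) : t = leaf 1 := by
  cases t with
  | leaf a =>
    have := h.1.mem_iff (a := a)
    simp [leaves] at this
    rw [this]
  | node l r =>
    have := h.1.length_eq
    have := l.length_leaves_pos
    have := r.length_leaves_pos
    simp [leaves] at *
    omega

theorem labelInv_vertexLabel {n : ℕ} (hn : 2 ≤ n) {t : BTree} (ht : t ∈ labelledTrees n) :
    LabelInv t (2 * n - 2) (vertexLabel n t) := by
  have := labelInv_foldl hn ht (k := n - 2) (by omega)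
  rwa [show n + (n - 2) = 2 * n - 2 by omega] at this

/-- All `2n - 2` labels are attributed to distinct non-root vertices, and there are only `2n - 2` of
these, so none is left out. -/
theorem vertexLabel_eq {n : ℕ} (hn : 2 ≤ n) {t v : BTree} (ht : t ∈ labelledTrees n)
    (hv : v ∈ t.vertices) (hne : v ≠ t) : vertexLabel n t v = some (fullLabel n t v) := by
  have h := labelInv_vertexLabel hn ht
  obtain ⟨c, hc⟩ : ∃ c, vertexLabel n t v = some c := by
    rw [← Option.ne_none_iff_exists']
    intro hnone
    have hcard := card_vertices (nodup_of_mem_labelledTrees ht)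
    have hl : t.leaves.length = n := by simpa using ht.1.length_eq
    have : Nonempty BTree := ⟨leaf 0⟩
    choose! g hg1 hg2 using h.surj
    have hinj : Set.InjOn g ((Finset.Icc 1 (2 * n - 2) : Finset ℕ) : Set ℕ) := by
      intro c hc d hd e
      rw [Finset.mem_coe, Finset.mem_Icc] at hc hd
      have h1 := hg2 c hc.1 hc.2
      rw [e, hg2 d hd.1 hd.2] at h1
      exact (Option.some.inj h1).symm
    have hmaps : ∀ c ∈ Finset.Icc 1 (2 * n - 2), g c ∈ (t.vertices.erase t).erase v := by
      intro c hc
      rw [Finset.mem_Icc] at hc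
      have h1 := hg2 c hc.1 hc.2
      refine Finset.mem_erase.2 ⟨?_, Finset.mem_erase.2 ⟨?_, hg1 c hc.1 hc.2⟩⟩
      · intro e; rw [e, hnone] at h1; cases h1
      · intro e; rw [e, h.root] at h1; cases h1
    have := Finset.card_le_card_of_injOn _ hmaps hinj
    rw [Finset.card_erase_of_mem (Finset.mem_erase.2 ⟨hne, hv⟩),
      Finset.card_erase_of_mem (self_mem_vertices t), Nat.card_Icc] at this
    omega
  rw [fullLabel, hc]; rfl

theorem fullLabel_root {n : ℕ} (hn : 2 ≤ n) {t : BTree} (ht : t ∈ labelledTrees n) :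
    fullLabel n t t = 2 * n - 1 := by
  rw [fullLabel, (labelInv_vertexLabel hn ht).root]; rfl

theorem goodLabel_fullLabel {n : ℕ} (hn : 1 ≤ n) {t : BTree} (ht : t ∈ labelledTrees n) :
    GoodLabel n t (fullLabel n t) := by
  rcases hn.eq_or_lt with rfl | hn
  · obtain rfl := eq_leaf_of_mem_labelledTrees_one ht
    have hl : ∀ a, fullLabel 1 (leaf 1) (leaf a) = a := fun a => rfl
    refine ⟨hl, hl 1, ?_, ?_, ?_, ?_, ?_⟩ <;> simp [vertices, hl]
    omega
  have h := labelInv_vertexLabel hn ht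
  have hd := nodup_of_mem_labelledTrees ht
  have hroot := fullLabel_root hn ht
  have hsome := fun v => vertexLabel_eq hn ht (v := v)
  have hlt : ∀ v ∈ t.vertices, v ≠ t → 1 ≤ fullLabel n t v ∧ fullLabel n t v ≤ 2 * n - 2 :=
    fun v hv hne => h.bound v hv _ (hsome v hv hne)
  have hchild : ∀ l r, node l r ∈ t.vertices → fullLabel n t l < fullLabel n t (node l r) ∧
      fullLabel n t r < fullLabel n t (node l r) := by
    intro l r hm
    have hl := hlt l (left_mem hm) (child_ne_root (Or.inl rfl) hm)
    have hr := hlt r (right_mem hm) (child_ne_root (Or.inr rfl) hm)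
    by_cases e : node l r = t
    · rw [e, hroot]; omega
    · obtain ⟨i, j, h1, h2, h3, h4⟩ := h.child l r hm _ (hsome _ hm e)
      have e1 : fullLabel n t l = i := by rw [fullLabel, h1]; rfl
      have e2 : fullLabel n t r = j := by rw [fullLabel, h2]; rfl
      omega
  have hinj : Set.InjOn (fullLabel n t) t.vertices := by
    intro v hv w hw e
    by_cases hvt : v = t <;> by_cases hwt : w = t
    · rw [hvt, hwt]
    · have := hlt w hw hwt; rw [hvt, hroot] at e; omega
    · have := hlt v hv hvt; rw [hwt, hroot] at e; omega
    · exact h.inj v hv w hw _ (hsome v hv hvt) (e ▸ hsome w hw hwt)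
  have hsurj : ∀ c, 1 ≤ c → c ≤ 2 * n - 1 → ∃ v ∈ t.vertices, fullLabel n t v = c := by
    intro c h1 h2
    rcases h2.eq_or_lt with rfl | h2
    · exact ⟨t, self_mem_vertices t, hroot⟩
    · obtain ⟨v, hv, e⟩ := h.surj c h1 (by omega)
      exact ⟨v, hv, by rw [fullLabel, e]; rfl⟩
  refine ⟨fun a => ?_, hroot, fun v hv => ?_, hinj, hsurj, hchild, ?_⟩
  · rw [fullLabel, h.leaf]; rfl
  · by_cases e : v = t
    · rw [e, hroot]; omega
    · have := hlt v hv e; omega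
  · intro l r hm l' r' hm' hle hl' hr'
    by_cases e' : node l' r' = t
    · by_cases e : node l r = t
      · obtain ⟨rfl, rfl⟩ := node.inj (e.trans e'.symm)
        rfl
      -- The root competes only with itself: the vertex labelled `2n - 2` must be a child of the
      -- root, so the children of the root are not both labelled before a non-root vertex.
      · exfalso
        have h1 := hlt _ hm e
        obtain ⟨u, hu, hu'⟩ := hsurj (2 * n - 2) (by omega) (by omega)
        obtain ⟨w, hw⟩ := exists_sib hu (by rintro rfl; omega)
        obtain ⟨a, b, hab, huab⟩ : ∃ a b, node a b ∈ t.vertices ∧ (u = a ∨ u = b) := by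
          rcases hw with hw | hw
          · exact ⟨_, _, hw, Or.inl rfl⟩
          · exact ⟨_, _, hw, Or.inr rfl⟩
        have hc := hchild a b hab
        have hab' : node a b = t := by
          by_contra hne
          have := hlt _ hab hne
          rcases huab with rfl | rfl <;> omega
        obtain ⟨rfl, rfl⟩ := node.inj (hab'.trans e'.symm)
        rcases huab with rfl | rfl <;> omega
    · have e : node l r ≠ t := by
        intro e
        have := hlt _ hm' e'
        rw [e, hroot] at hle
        omega
      refine h.min l r hm _ _ _ (hsome _ hm e)
        (hsome _ (left_mem hm) (child_ne_root (Or.inl rfl) hm))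
        (hsome _ (right_mem hm) (child_ne_root (Or.inr rfl) hm)) l' r' hm' e' (fun d hd => ?_) _ _
        (hsome _ (left_mem hm') (child_ne_root (Or.inl rfl) hm'))
        (hsome _ (right_mem hm') (child_ne_root (Or.inr rfl) hm')) hl' hr'
      rw [hsome _ hm' e'] at hd
      exact (Option.some.inj hd) ▸ hle

end WellLabelled

namespace WellLabelled
open BTree

/-! ### The matching of a tree -/

theorem not_areSiblingLabels_one {t : BTree} (ht : t ∈ labelledTrees 1) (i j : ℕ) :
    ¬ AreSiblingLabels 1 t i j := by
  rintro ⟨l, r, hm, -⟩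
  rw [eq_leaf_of_mem_labelledTrees_one ht] at hm
  simp [vertices] at hm

theorem areSiblingLabels_iff {n : ℕ} (hn : 1 ≤ n) {t : BTree} (ht : t ∈ labelledTrees n)
    {i j : ℕ} :
    AreSiblingLabels n t i j ↔ ∃ v w, Sib t v w ∧ fullLabel n t v = i ∧ fullLabel n t w = j := by
  rcases hn.eq_or_lt with rfl | hn
  · refine iff_of_false (not_areSiblingLabels_one ht i j) ?_
    rintro ⟨v, w, hs, -⟩
    have h1 := hs.left
    have h2 := hs.ne_root
    rw [eq_leaf_of_mem_labelledTrees_one ht] at h1 h2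
    simp [vertices] at h1
    exact h2 h1
  have hl : ∀ l r, node l r ∈ t.vertices → vertexLabel n t l = some (fullLabel n t l) :=
    fun l r hm => vertexLabel_eq hn ht (left_mem hm) (child_ne_root (Or.inl rfl) hm)
  have hr : ∀ l r, node l r ∈ t.vertices → vertexLabel n t r = some (fullLabel n t r) :=
    fun l r hm => vertexLabel_eq hn ht (right_mem hm) (child_ne_root (Or.inr rfl) hm)
  constructor
  · rintro ⟨l, r, hm, h⟩
    rw [hl l r hm, hr l r hm] at h
    simp only [Option.some.injEq] at h
    rcases h with ⟨h1, h2⟩ | ⟨h1, h2⟩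
    · exact ⟨l, r, Or.inl hm, h1, h2⟩
    · exact ⟨r, l, Or.inr hm, h2, h1⟩
  · rintro ⟨v, w, hm | hm, rfl, rfl⟩
    · exact ⟨v, w, hm, Or.inl ⟨hl _ _ hm, hr _ _ hm⟩⟩
    · exact ⟨w, v, hm, Or.inr ⟨hl _ _ hm, hr _ _ hm⟩⟩

/-- The choice in `Psi` is forced: a label determines its vertex, and a vertex has one sibling. -/
theorem Psi_fullLabel {n : ℕ} (hn : 1 ≤ n) {t v w : BTree} (ht : t ∈ labelledTrees n)
    (h : Sib t v w) : Psi n t (fullLabel n t v) = fullLabel n t w := by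
  have hex : ∃ j, AreSiblingLabels n t (fullLabel n t v) j :=
    ⟨_, (areSiblingLabels_iff hn ht).2 ⟨v, w, h, rfl, rfl⟩⟩
  rw [Psi, dif_pos hex]
  obtain ⟨v', w', hs, h1, h2⟩ := (areSiblingLabels_iff hn ht).1 hex.choose_spec
  rw [← h2]
  obtain rfl := (goodLabel_fullLabel hn ht).inj hs.left h.left h1
  rw [hs.unique (nodup_of_mem_labelledTrees ht) h]

theorem label_mem_iff_of_sib {n : ℕ} (hn : 1 ≤ n) {t v : BTree} (ht : t ∈ labelledTrees n)
    (hv : v ∈ t.vertices) (hne : v ≠ t) : fullLabel n t v ∈ Finset.Icc 1 (2 * n - 2) := by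
  have h := goodLabel_fullLabel hn ht
  have h1 := h.bound v hv
  have h2 : fullLabel n t v ≠ 2 * n - 1 := fun e =>
    hne (h.inj hv (self_mem_vertices t) (e.trans h.root.symm))
  rw [Finset.mem_Icc]; omega

theorem Psi_of_notMem {n : ℕ} (hn : 1 ≤ n) {t : BTree} (ht : t ∈ labelledTrees n) {i : ℕ}
    (hi : i ∉ Finset.Icc 1 (2 * n - 2)) : Psi n t i = i := by
  rw [Psi, dif_neg]
  rintro ⟨j, hj⟩
  obtain ⟨v, w, hs, rfl, -⟩ := (areSiblingLabels_iff hn ht).1 hj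
  exact hi (label_mem_iff_of_sib hn ht hs.left hs.ne_root)

theorem exists_sib_of_mem {n : ℕ} (hn : 1 ≤ n) {t : BTree} (ht : t ∈ labelledTrees n) {i : ℕ}
    (hi : i ∈ Finset.Icc 1 (2 * n - 2)) : ∃ v w, Sib t v w ∧ fullLabel n t v = i := by
  have h := goodLabel_fullLabel hn ht
  rw [Finset.mem_Icc] at hi
  obtain ⟨v, hv, rfl⟩ := h.surj i hi.1 (by omega)
  obtain ⟨w, hw⟩ := exists_sib hv (by rintro rfl; rw [h.root] at hi; omega)
  exact ⟨v, w, hw, rfl⟩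

theorem Psi_mem {n : ℕ} (hn : 1 ≤ n) {t : BTree} (ht : t ∈ labelledTrees n) :
    Psi n t ∈ matchings (2 * n - 2) := by
  constructor
  · intro i
    by_cases hi : i ∈ Finset.Icc 1 (2 * n - 2)
    · obtain ⟨v, w, hs, rfl⟩ := exists_sib_of_mem hn ht hi
      rw [Psi_fullLabel hn ht hs, Psi_fullLabel hn ht hs.symm]
    · rw [Psi_of_notMem hn ht hi, Psi_of_notMem hn ht hi]
  · intro i
    refine ⟨fun h => by_contra fun hi => h (Psi_of_notMem hn ht hi), fun hi => ?_⟩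
    obtain ⟨v, w, hs, rfl⟩ := exists_sib_of_mem hn ht hi
    rw [Psi_fullLabel hn ht hs]
    intro e
    exact hs.ne (nodup_of_mem_labelledTrees ht)
      ((goodLabel_fullLabel hn ht).inj hs.symm.left hs.left e).symm

/-- If the vertices with labels less than `c` are the same in two trees with the same matching,
then the children in the first tree of its vertex labelled `c` are also siblings in the second. -/
theorem node_mem_of_Psi_eq {n : ℕ} (hn : 1 ≤ n) {t t' : BTree} (ht : t ∈ labelledTrees n)
    (ht' : t' ∈ labelledTrees n) (e : Psi n t = Psi n t') {c : ℕ}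
    (ih : ∀ d < c, ∀ v ∈ t.vertices, ∀ v' ∈ t'.vertices, fullLabel n t v = d →
      fullLabel n t' v' = d → v = v') {l r l' r' : BTree} (hv : node l r ∈ t.vertices)
    (hv' : node l' r' ∈ t'.vertices) (hc : fullLabel n t (node l r) = c)
    (hc' : fullLabel n t' (node l' r') = c) :
    node l r ∈ t'.vertices ∧ fullLabel n t' l = fullLabel n t l ∧
      fullLabel n t' r = fullLabel n t r ∧
      min (fullLabel n t' l') (fullLabel n t' r') ≤ min (fullLabel n t l) (fullLabel n t r) := by
  have h := goodLabel_fullLabel hn ht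
  have h' := goodLabel_fullLabel hn ht'
  have hch := h.child l r hv
  have same : ∀ u ∈ t.vertices, fullLabel n t u < c →
      u ∈ t'.vertices ∧ fullLabel n t' u = fullLabel n t u := by
    intro u hu huc
    have hb := h.bound u hu
    obtain ⟨u', hu', eu⟩ := h'.surj _ hb.1 hb.2
    obtain rfl := ih _ huc u hu u' hu' rfl eu
    exact ⟨hu', eu⟩
  obtain ⟨hl1, hl2⟩ := same l (left_mem hv) (by omega)
  obtain ⟨hr1, hr2⟩ := same r (right_mem hv) (by omega)
  have hlt : l ≠ t' := by
    rintro rfl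
    have := h.bound _ hv
    rw [h'.root] at hl2
    omega
  obtain ⟨w, hw⟩ := exists_sib hl1 hlt
  have e1 := Psi_fullLabel hn ht (Or.inl hv : Sib t l r)
  have e2 := Psi_fullLabel hn ht' hw
  rw [hl2, ← e, e1, ← hr2] at e2
  obtain rfl := h'.inj hr1 hw.symm.left e2
  -- The order in which the two siblings are written is fixed by their least leaves, hence is the
  -- same in both trees.
  have hmem : node l r ∈ t'.vertices := by
    rcases hw with hw | hw
    · exact hw
    · have n1 := (normal_of_mem ht.2 hv).1
      have n2 := (normal_of_mem ht'.2 hw).1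
      omega
  refine ⟨hmem, hl2, hr2, ?_⟩
  -- With a label below `c` in the second tree, this vertex would by `ih` have the same label in the
  -- first. It is therefore a competitor for `c` in the second tree, and greediness compares the two
  -- pairs of children.
  have hge : c ≤ fullLabel n t' (node l r) := by
    by_contra hlt
    have hb := h'.bound _ hmem
    obtain ⟨u, hu, eu⟩ := h.surj _ hb.1 hb.2
    obtain rfl := ih _ (not_le.1 hlt) u hu _ hmem eu rfl
    omega
  have := h'.min l' r' hv' l r hmem (by omega) (by omega) (by omega)
  rwa [hl2, hr2] at this

/-- Induction on `c` shows that the vertices labelled `c` coincide in the two trees. Labels up to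
`n` belong to leaves; for the others `node_mem_of_Psi_eq` is used in both directions. The case of
the root gives the result. -/
theorem injOn_Psi {n : ℕ} (hn : 1 ≤ n) : Set.InjOn (Psi n) (labelledTrees n) := by
  intro t ht t' ht' e
  have h := goodLabel_fullLabel hn ht
  have h' := goodLabel_fullLabel hn ht'
  have hd' := nodup_of_mem_labelledTrees ht'
  have leaf_le : ∀ {t : BTree}, t ∈ labelledTrees n → ∀ a, leaf a ∈ t.vertices → a ≤ n := by
    intro t ht a ha
    have := leaves_subset ha (by simp [leaves] : a ∈ (leaf a).leaves)
    rw [ht.1.mem_iff, List.mem_range'_1] at this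
    omega
  have leaf_mem : ∀ {t : BTree}, t ∈ labelledTrees n → ∀ a, 1 ≤ a → a ≤ n →
      leaf a ∈ t.vertices := by
    intro t ht a h1 h2
    exact leaf_mem_vertices (by rw [ht.1.mem_iff, List.mem_range'_1]; omega)
  have key : ∀ c, ∀ v ∈ t.vertices, ∀ v' ∈ t'.vertices, fullLabel n t v = c →
      fullLabel n t' v' = c → v = v' := by
    intro c
    induction c using Nat.strong_induction_on with
    | _ c ih =>
      intro v hv v' hv' hc hc'
      have hb := h.bound v hv
      by_cases hcn : c ≤ n
      · have e1 := h.inj hv (leaf_mem ht c (by omega) hcn) (hc.trans (h.leaf c).symm)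
        have e2 := h'.inj hv' (leaf_mem ht' c (by omega) hcn) (hc'.trans (h'.leaf c).symm)
        rw [e1, e2]
      · cases v with
        | leaf a =>
          rw [h.leaf] at hc
          have := leaf_le ht a hv
          omega
        | node l r =>
        cases v' with
        | leaf a =>
          rw [h'.leaf] at hc'
          have := leaf_le ht' a hv'
          omega
        | node l' r' =>
        obtain ⟨h1, h2, h3, h4⟩ := node_mem_of_Psi_eq hn ht ht' e ih hv hv' hc hc'
        obtain ⟨-, h6, h7, h8⟩ := node_mem_of_Psi_eq hn ht' ht e.symm
          (fun d hd v hv v' hv' a b => (ih d hd v' hv' v hv b a).symm) hv' hv hc' hc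
        rw [← h2, ← h3] at h4 h8
        -- The two pairs of siblings have the same least label, hence share a vertex, and its parent
        -- is unique.
        have hm := le_antisymm h4 h8
        have hinj : ∀ x ∈ t'.vertices, ∀ y ∈ t'.vertices,
            fullLabel n t' x = fullLabel n t' y → x = y := fun x hx y hy => h'.inj hx hy
        have a1 := hinj _ (left_mem h1) _ (left_mem hv')
        have a2 := hinj _ (left_mem h1) _ (right_mem hv')
        have a3 := hinj _ (right_mem h1) _ (left_mem hv')
        have a4 := hinj _ (right_mem h1) _ (right_mem hv')
        rcases min_choice (fullLabel n t' l) (fullLabel n t' r) with m1 | m1 <;>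
          rcases min_choice (fullLabel n t' l') (fullLabel n t' r') with m2 | m2 <;>
          rw [m1, m2] at hm
        · exact parent_unique hd' h1 hv' (Or.inl rfl) (Or.inl (a1 hm.symm))
        · exact parent_unique hd' h1 hv' (Or.inl rfl) (Or.inr (a2 hm.symm))
        · exact parent_unique hd' h1 hv' (Or.inr rfl) (Or.inl (a3 hm.symm))
        · exact parent_unique hd' h1 hv' (Or.inr rfl) (Or.inr (a4 hm.symm))
  exact key _ t (self_mem_vertices t) t' (self_mem_vertices t') h.root h'.root

/-! ### Adding a pair to a matching -/

theorem conj_mem_matchings {m : ℕ} {π : ℕ → ℕ} (h : π ∈ matchings m) {a b : ℕ}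
    (ha : a ∈ Finset.Icc 1 m) (hb : b ∈ Finset.Icc 1 m) :
    (fun i => Equiv.swap a b (π (Equiv.swap a b i))) ∈ matchings m := by
  refine ⟨fun i => by simp [h.1 _], fun i => ?_⟩
  have : Equiv.swap a b (π (Equiv.swap a b i)) ≠ i ↔
      π (Equiv.swap a b i) ≠ Equiv.swap a b i := by
    rw [not_iff_not]
    constructor
    · intro e; conv_rhs => rw [← e]
      simp
    · intro e; rw [e]; simp
  refine this.trans ((h.2 _).trans ?_)
  rw [Equiv.swap_apply_def]
  split_ifs with h1 h2
  · rw [h1]; exact iff_of_true hb ha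
  · rw [h2]; exact iff_of_true ha hb
  · rfl

theorem matchings_apply_of_lt {m : ℕ} {π : ℕ → ℕ} (h : π ∈ matchings m) {i : ℕ} (hi : m < i) :
    π i = i := by
  by_contra hne
  have := (h.2 i).1 hne
  rw [Finset.mem_Icc] at this; omega

theorem matchings_apply_mem {m : ℕ} {π : ℕ → ℕ} (h : π ∈ matchings m) {i : ℕ}
    (hi : i ∈ Finset.Icc 1 m) : π i ∈ Finset.Icc 1 m := by
  refine (h.2 _).1 ?_
  rw [h.1]
  exact ((h.2 _).2 hi).symm

/-- `π` fixes `m + 1` and `m + 2`, so the transposition adds them as a pair;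
`comp_swap_mem_matchings_of_pair` removes such a pair again. -/
theorem comp_swap_mem_matchings {m : ℕ} {π : ℕ → ℕ} (h : π ∈ matchings m) :
    (fun i => π (Equiv.swap (m + 1) (m + 2) i)) ∈ matchings (m + 2) := by
  have e1 := matchings_apply_of_lt h (show m < m + 1 by omega)
  have e2 := matchings_apply_of_lt h (show m < m + 2 by omega)
  have e0 : π 0 = 0 := by
    by_contra hne
    simpa using (h.2 0).1 hne
  have hc : ∀ i, i = m + 1 ∨ i = m + 2 ∨ (Equiv.swap (m + 1) (m + 2) i = i ∧
      Equiv.swap (m + 1) (m + 2) (π i) = π i) := by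
    intro i
    by_cases h1 : i = m + 1
    · exact Or.inl h1
    by_cases h2 : i = m + 2
    · exact Or.inr (Or.inl h2)
    refine Or.inr (Or.inr ⟨Equiv.swap_apply_of_ne_of_ne h1 h2,
      Equiv.swap_apply_of_ne_of_ne (fun e => ?_) fun e => ?_⟩)
    · have := h.1 i; rw [e, e1] at this; omega
    · have := h.1 i; rw [e, e2] at this; omega
  constructor
  · intro i
    rcases hc i with rfl | rfl | ⟨h1, h2⟩
    · simp [e1, e2]
    · simp [e1, e2]
    · simp only [h1, h2]; exact h.1 i
  · intro i
    rcases hc i with rfl | rfl | ⟨h1, h2⟩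
    · simp [e2]
    · simp [e1]
    · simp only [h1]
      rw [h.2]
      simp only [Finset.mem_Icc]
      have h3 : i ≠ m + 1 := by rintro rfl; simp at h1
      have h4 : i ≠ m + 2 := by rintro rfl; simp at h1
      omega

theorem comp_swap_mem_matchings_of_pair {m : ℕ} {π : ℕ → ℕ} (h : π ∈ matchings (m + 2))
    (hp : π (m + 2) = m + 1) : (fun i => π (Equiv.swap (m + 1) (m + 2) i)) ∈ matchings m := by
  have hp' : π (m + 1) = m + 2 := by rw [← hp, h.1]
  have hc : ∀ i, i = m + 1 ∨ i = m + 2 ∨ (i ≠ m + 1 ∧ i ≠ m + 2 ∧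
      Equiv.swap (m + 1) (m + 2) i = i ∧ Equiv.swap (m + 1) (m + 2) (π i) = π i) := by
    intro i
    by_cases h1 : i = m + 1
    · exact Or.inl h1
    by_cases h2 : i = m + 2
    · exact Or.inr (Or.inl h2)
    refine Or.inr (Or.inr ⟨h1, h2, Equiv.swap_apply_of_ne_of_ne h1 h2,
      Equiv.swap_apply_of_ne_of_ne (fun e => ?_) fun e => ?_⟩)
    · have := h.1 i; rw [e, hp'] at this; omega
    · have := h.1 i; rw [e, hp] at this; omega
  constructor
  · intro i
    rcases hc i with rfl | rfl | ⟨-, -, h1, h2⟩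
    · simp [hp]
    · simp [hp']
    · simp only [h1, h2]; exact h.1 i
  · intro i
    rcases hc i with rfl | rfl | ⟨h3, h4, h1, h2⟩
    · simp [hp]
    · simp [hp']
    · simp only [h1]
      rw [h.2]
      simp only [Finset.mem_Icc]
      omega

/-- The matching of size `m + 2` in which `m + 2` is paired with `k`, and `m + 1` with the former
partner of `k`. -/
def addPair (m : ℕ) (p : ℕ × (ℕ → ℕ)) (i : ℕ) : ℕ :=
  Equiv.swap p.1 (m + 1) (p.2 (Equiv.swap (m + 1) (m + 2) (Equiv.swap p.1 (m + 1) i)))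

theorem addPair_last {m : ℕ} {p : ℕ × (ℕ → ℕ)} (h1 : p.1 ∈ Finset.Icc 1 (m + 1))
    (h2 : p.2 ∈ matchings m) : addPair m p (m + 2) = p.1 := by
  rw [Finset.mem_Icc] at h1
  rw [addPair, Equiv.swap_apply_of_ne_of_ne (show m + 2 ≠ p.1 by omega) (by omega),
    Equiv.swap_apply_right, matchings_apply_of_lt h2 (by omega), Equiv.swap_apply_right]

/-- The number `k` is recovered as the partner of `m + 2`. Exchanging `k` and `m + 1` then turns `{m
+ 1, m + 2}` into a pair that can be removed. -/
theorem bijOn_addPair (m : ℕ) :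
    Set.BijOn (addPair m) ((Finset.Icc 1 (m + 1) : Finset ℕ) ×ˢ matchings m)
      (matchings (m + 2)) := by
  have hsub : ∀ k ∈ Finset.Icc 1 (m + 1), k ∈ Finset.Icc 1 (m + 2) := fun k hk => by
    rw [Finset.mem_Icc] at *; omega
  have hm1 : m + 1 ∈ Finset.Icc 1 (m + 2) := by rw [Finset.mem_Icc]; omega
  refine Set.BijOn.mk ?_ ?_ ?_
  · rintro ⟨k, π⟩ ⟨hk, hπ⟩
    exact conj_mem_matchings (comp_swap_mem_matchings hπ) (hsub k hk) hm1
  · rintro ⟨k, π⟩ ⟨hk, hπ⟩ ⟨k', π'⟩ ⟨hk', hπ'⟩ e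
    have e1 := addPair_last hk hπ
    rw [e, addPair_last hk' hπ'] at e1
    simp only at e1
    subst e1
    congr 1
    funext i
    have := congrFun e (Equiv.swap k' (m + 1) (Equiv.swap (m + 1) (m + 2) i))
    simpa [addPair] using this
  · intro σ hσ
    have hlast : m + 2 ∈ Finset.Icc 1 (m + 2) := by rw [Finset.mem_Icc]; omega
    have hk : σ (m + 2) ∈ Finset.Icc 1 (m + 1) := by
      have h1 := matchings_apply_mem hσ hlast
      have h2 := (hσ.2 _).2 hlast
      rw [Finset.mem_Icc] at *
      omega
    have hk' := Finset.mem_Icc.1 hk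
    have hs : Equiv.swap (σ (m + 2)) (m + 1) (m + 2) = m + 2 :=
      Equiv.swap_apply_of_ne_of_ne (by omega) (by omega)
    refine ⟨(σ (m + 2), fun i => Equiv.swap (σ (m + 2)) (m + 1) (σ (Equiv.swap (σ (m + 2)) (m + 1)
      (Equiv.swap (m + 1) (m + 2) i)))), ⟨hk, ?_⟩, ?_⟩
    · refine comp_swap_mem_matchings_of_pair (conj_mem_matchings hσ (hsub _ hk) hm1) ?_
      rw [hs, Equiv.swap_apply_left]
    · funext i
      simp [addPair]

theorem matchings_zero : matchings 0 = {id} := by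
  ext π
  simp only [matchings, Set.mem_ofPred_eq, Set.mem_singleton_iff]
  constructor
  · rintro ⟨-, h⟩
    funext i
    by_contra hne
    simpa using (h i).1 hne
  · rintro rfl
    exact ⟨fun i => rfl, fun i => by simp⟩

theorem finite_ncard_matchings (n : ℕ) : (matchings (2 * n)).Finite ∧
    (matchings (2 * n)).ncard = Nat.doubleFactorial (2 * n - 1) := by
  induction n with
  -- The truncated `2 * 0 - 1` is `0`, with double factorial `1`, as there is one empty matching.
  | zero => rw [Nat.mul_zero, matchings_zero]; simp
  | succ n ih =>
    have h := bijOn_addPair (2 * n)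
    rw [Nat.mul_succ]
    constructor
    · rw [← h.image_eq]
      exact ((Finset.finite_toSet _).prod ih.1).image _
    · rw [← h.image_eq, h.injOn.ncard_image, Set.ncard_prod, Set.ncard_coe_finset, Nat.card_Icc,
        ih.2]
      cases n with
      | zero => simp
      | succ n =>
        rw [show 2 * (n + 1) + 2 - 1 = 2 * n + 1 + 2 by omega, Nat.doubleFactorial_add_two]
        congr 1

end WellLabelled

namespace WellLabelled
open BTree

/-! ### Counting trees -/

namespace BTree

/-- The tree obtained by inserting a new leaf `a` as a sibling of the vertex `v`. -/
def insertAt (v : BTree) (a : ℕ) : BTree → BTree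
  | leaf b => if leaf b = v then node (leaf b) (leaf a) else leaf b
  | node l r =>
    if node l r = v then node (node l r) (leaf a) else node (insertAt v a l) (insertAt v a r)

/-- The tree obtained by deleting the leaf `a`, when it is a right child. -/
def prune (a : ℕ) : BTree → BTree
  | leaf b => leaf b
  | node l r => if r = leaf a then l else node (prune a l) (prune a r)

theorem insertAt_self (v : BTree) (a : ℕ) : insertAt v a v = node v (leaf a) := by
  cases v <;> simp [insertAt]

theorem insertAt_of_notMem {v t : BTree} (a : ℕ) (h : v ∉ t.vertices) : insertAt v a t = t := by
  induction t with
  | leaf b =>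
    have : leaf b ≠ v := fun e => h (by simp [vertices, e])
    simp [insertAt, this]
  | node l r hl hr =>
    rw [mem_vertices_node] at h
    push Not at h
    rw [insertAt, if_neg h.1.symm, hl h.2.1, hr h.2.2]

theorem leaves_insertAt {v t : BTree} (a : ℕ) (h : t.leaves.Nodup) (hv : v ∈ t.vertices) :
    (insertAt v a t).leaves.Perm (t.leaves ++ [a]) := by
  induction t with
  | leaf b =>
    have : v = leaf b := by simpa [vertices] using hv
    rw [this, insertAt_self]
    exact List.Perm.refl _
  | node l r hl hr =>
    obtain ⟨hl', hr', -⟩ := List.nodup_append.1 h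
    have hd := disjoint_of_nodup h
    by_cases e : v = node l r
    · rw [e, insertAt_self]
      exact List.Perm.refl _
    rw [insertAt, if_neg (Ne.symm e)]
    rcases (mem_vertices_node.1 hv).resolve_left e with hv | hv
    · rw [insertAt_of_notMem a (not_mem_vertices_of_disjoint hd.symm hv)]
      simp only [leaves, List.append_assoc]
      refine ((hl hl' hv).append_right _).trans ?_
      rw [List.append_assoc]
      exact List.perm_append_comm.append_left _
    · rw [insertAt_of_notMem a (not_mem_vertices_of_disjoint hd hv)]
      simp only [leaves, List.append_assoc]
      exact (hr hr' hv).append_left _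

theorem minLeaf_insertAt (v : BTree) {a : ℕ} {t : BTree} (h : ∀ b ∈ t.leaves, b < a) :
    (insertAt v a t).minLeaf = t.minLeaf := by
  have hmin := h _ t.minLeaf_mem
  induction t with
  | leaf b =>
    unfold insertAt
    split_ifs
    · simp only [minLeaf] at *; omega
    · rfl
  | node l r hl hr =>
    have h1 : ∀ b ∈ l.leaves, b < a := fun b hb => h b (by simp [leaves, hb])
    have h2 : ∀ b ∈ r.leaves, b < a := fun b hb => h b (by simp [leaves, hb])
    unfold insertAt
    split_ifs
    · simp only [minLeaf] at *; omega
    · rw [minLeaf, hl h1 (h1 _ l.minLeaf_mem), hr h2 (h2 _ r.minLeaf_mem), minLeaf]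

/-- The new label exceeds all the others, so the new leaf is rightly a right child and no least leaf
changes. -/
theorem normal_insertAt (v : BTree) {a : ℕ} {t : BTree} (ht : t.Normal)
    (h : ∀ b ∈ t.leaves, b < a) : (insertAt v a t).Normal := by
  have hmin := h _ t.minLeaf_mem
  induction t with
  | leaf b =>
    unfold insertAt
    split_ifs
    · exact ⟨hmin, trivial, trivial⟩
    · trivial
  | node l r hl hr =>
    have h1 : ∀ b ∈ l.leaves, b < a := fun b hb => h b (by simp [leaves, hb])
    have h2 : ∀ b ∈ r.leaves, b < a := fun b hb => h b (by simp [leaves, hb])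
    unfold insertAt
    split_ifs
    · exact ⟨hmin, ht, trivial⟩
    · refine ⟨?_, hl ht.2.1 h1 (h1 _ l.minLeaf_mem), hr ht.2.2 h2 (h2 _ r.minLeaf_mem)⟩
      rw [minLeaf_insertAt v h1, minLeaf_insertAt v h2]
      exact ht.1

theorem node_mem_insertAt {v t : BTree} (a : ℕ) (hv : v ∈ t.vertices) :
    node v (leaf a) ∈ (insertAt v a t).vertices := by
  induction t with
  | leaf b =>
    have : v = leaf b := by simpa [vertices] using hv
    rw [this, insertAt_self]
    exact self_mem_vertices _
  | node l r hl hr =>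
    by_cases e : v = node l r
    · rw [e, insertAt_self]
      exact self_mem_vertices _
    rw [insertAt, if_neg (Ne.symm e), mem_vertices_node]
    rcases (mem_vertices_node.1 hv).resolve_left e with hv | hv
    · exact Or.inr (Or.inl (hl hv))
    · exact Or.inr (Or.inr (hr hv))

theorem prune_insertAt (v : BTree) {a : ℕ} {t : BTree} (h : a ∉ t.leaves) :
    prune a (insertAt v a t) = t := by
  have hleaf : ∀ t : BTree, a ∉ t.leaves → insertAt v a t ≠ leaf a := by
    intro t ht
    cases t <;> unfold insertAt <;> split_ifs <;> simp_all [leaves, eq_comm]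
  induction t with
  | leaf b =>
    unfold insertAt
    split_ifs <;> simp [prune]
  | node l r hl hr =>
    simp only [leaves, List.mem_append, not_or] at h
    unfold insertAt
    split_ifs
    · simp [prune]
    · rw [prune, if_neg (hleaf r h.2), hl h.1, hr h.2]

end BTree

theorem lt_of_mem_labelledTrees {n : ℕ} {t : BTree} (ht : t ∈ labelledTrees n) :
    ∀ b ∈ t.leaves, b < n + 1 := fun b hb => by
  rw [ht.1.mem_iff, List.mem_range'_1] at hb; omega

theorem insertAt_mem {n : ℕ} {m : BTree × BTree} (h : m ∈ markedTrees n) :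
    insertAt m.2 (n + 1) m.1 ∈ labelledTrees (n + 1) := by
  have hd := nodup_of_mem_labelledTrees h.1
  refine ⟨(leaves_insertAt _ hd h.2).trans ?_,
    normal_insertAt _ h.1.2 (lt_of_mem_labelledTrees h.1)⟩
  rw [List.range'_concat, one_mul, add_comm 1 n]
  exact h.1.1.append_right _

/-- Pruning the leaf `n + 1` gives back the tree, and the marked vertex is the sibling of that leaf.
-/
theorem injOn_insertAt (n : ℕ) :
    Set.InjOn (fun m : BTree × BTree => insertAt m.2 (n + 1) m.1) (markedTrees n) := by
  rintro ⟨t, v⟩ h ⟨t', v'⟩ h' e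
  have hn := nodup_of_mem_labelledTrees (insertAt_mem h')
  have h1 := node_mem_insertAt (n + 1) h.2
  have h2 := node_mem_insertAt (n + 1) h'.2
  have e1 := prune_insertAt v (fun hm => lt_irrefl _ (lt_of_mem_labelledTrees h.1 _ hm))
  have e2 := prune_insertAt v' (fun hm => lt_irrefl _ (lt_of_mem_labelledTrees h'.1 _ hm))
  simp only at e h1 h2 e1 e2 hn
  rw [e] at e1 h1
  have hp := parent_unique hn h1 h2 (Or.inr rfl) (Or.inr rfl)
  rw [← e1, e2, (node.inj hp).1]

/-- The marked vertex of a tree is determined by its label. -/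
theorem bijOn_mark {n : ℕ} (hn : 1 ≤ n) :
    Set.BijOn (fun m : BTree × BTree => (fullLabel n m.1 m.2, m.1)) (markedTrees n)
      ((Finset.Icc 1 (2 * n - 2 + 1) : Finset ℕ) ×ˢ labelledTrees n) := by
  refine Set.BijOn.mk ?_ ?_ ?_
  · rintro ⟨t, v⟩ ⟨ht, hv⟩
    have := (goodLabel_fullLabel hn ht).bound v hv
    refine ⟨?_, ht⟩
    rw [Finset.mem_coe, Finset.mem_Icc]
    exact ⟨this.1, this.2.trans (by omega)⟩
  · rintro ⟨t, v⟩ ⟨ht, hv⟩ ⟨t', v'⟩ ⟨ht', hv'⟩ e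
    obtain ⟨e1, rfl⟩ := Prod.mk.inj e
    exact congrArg _ ((goodLabel_fullLabel hn ht).inj hv hv' e1)
  · rintro ⟨c, t⟩ ⟨hc, ht⟩
    rw [Finset.mem_coe, Finset.mem_Icc] at hc
    simp only at hc ht
    obtain ⟨v, hv, rfl⟩ := (goodLabel_fullLabel hn ht).surj c hc.1 (by omega)
    exact ⟨(t, v), ⟨ht, hv⟩, rfl⟩

theorem finite_matchings_sub (n : ℕ) : (matchings (2 * n - 2)).Finite := by
  have := (finite_ncard_matchings (n - 1)).1
  rwa [show 2 * (n - 1) = 2 * n - 2 by omega] at this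

theorem finite_labelledTrees {n : ℕ} (hn : 1 ≤ n) : (labelledTrees n).Finite :=
  Set.Finite.of_injOn (fun _ ht => Psi_mem hn ht) (injOn_Psi hn) (finite_matchings_sub n)

/-- From `n` to `n + 1` the number of matchings is multiplied by `2n - 1`, and the number of trees
at least by this factor, as each of the `2n - 1` vertices is a place to insert a leaf. Since `Psi`
is injective, the inequality suffices. -/
theorem ncard_matchings_le {n : ℕ} (hn : 1 ≤ n) :
    (matchings (2 * n - 2)).ncard ≤ (labelledTrees n).ncard := by
  induction n, hn using Nat.le_induction with
  | base =>
    have : (labelledTrees 1).Nonempty := ⟨leaf 1, by simp [leaves], trivial⟩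
    rw [show 2 * 1 - 2 = 0 from rfl, matchings_zero, Set.ncard_singleton]
    exact (Set.ncard_pos (finite_labelledTrees le_rfl)).2 this
  | succ n hn ih =>
    have h1 := Set.ncard_le_ncard_of_injOn _ (fun m hm => insertAt_mem hm) (injOn_insertAt n)
      (finite_labelledTrees (by omega))
    have h2 := bijOn_mark hn
    have h3 := h2.injOn.ncard_image
    rw [h2.image_eq, Set.ncard_prod] at h3
    have h4 := bijOn_addPair (2 * n - 2)
    have h5 := h4.injOn.ncard_image
    rw [h4.image_eq, Set.ncard_prod] at h5
    rw [show 2 * (n + 1) - 2 = 2 * n - 2 + 2 by omega, h5]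
    exact (Nat.mul_le_mul_left _ ih).trans (h3.le.trans h1)

theorem bijOn_Psi {n : ℕ} (hn : 1 ≤ n) :
    Set.BijOn (Psi n) (labelledTrees n) (matchings (2 * n - 2)) := by
  have hm : Set.MapsTo (Psi n) (labelledTrees n) (matchings (2 * n - 2)) := fun _ ht =>
    Psi_mem hn ht
  refine ⟨hm, injOn_Psi hn, ?_⟩
  have : Psi n '' labelledTrees n = matchings (2 * n - 2) :=
    Set.eq_of_subset_of_ncard_le hm.image_subset
      ((ncard_matchings_le hn).trans (injOn_Psi hn).ncard_image.ge) (finite_matchings_sub n)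
  exact this.ge

/-! ### The matching of a marked tree -/

/-- The label `2n - 1` of the root makes the exchange in `addPair` trivial, which just adds the pair
`{2n - 1, 2n}`. Both cases of `PsiMarked` thus become one formula. -/
theorem PsiMarked_eq {n : ℕ} (hn : 1 ≤ n) {m : BTree × BTree} (hm : m ∈ markedTrees n) :
    PsiMarked n m = addPair (2 * n - 2) (fullLabel n m.1 m.2, Psi n m.1) := by
  obtain ⟨t, v⟩ := m
  obtain ⟨ht, hv⟩ := hm
  simp only at ht hv
  have hπ := Psi_mem hn ht
  have hfix := fun i hi => matchings_apply_of_lt hπ (i := i) hi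
  have hlt : ∀ i, i ≠ 2 * n - 1 → i ≠ 2 * n → Psi n t i ≠ 2 * n - 1 ∧ Psi n t i ≠ 2 * n := by
    intro i h1 h2
    constructor <;> intro e
    · have := hπ.1 i
      rw [e, hfix _ (by omega)] at this
      exact h1 this.symm
    · have := hπ.1 i
      rw [e, hfix _ (by omega)] at this
      exact h2 this.symm
  have e1 := hfix (2 * n - 1) (by omega)
  have e2 := hfix (2 * n) (by omega)
  funext i
  unfold PsiMarked addPair
  simp only [show 2 * n - 2 + 1 = 2 * n - 1 by omega, show 2 * n - 2 + 2 = 2 * n by omega]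
  by_cases hvt : v = t
  · rw [if_pos hvt, hvt, (goodLabel_fullLabel hn ht).root]
    simp only [Equiv.swap_self, Equiv.refl_apply, Function.update_apply, Equiv.swap_apply_def]
    split_ifs with h1 h2
    · omega
    · rw [e1]
    · rw [e2]
    · rfl
  · rw [if_neg hvt]
    have hn2 : 2 ≤ n := by
      rcases hn.eq_or_lt with rfl | h
      · rw [eq_leaf_of_mem_labelledTrees_one ht] at hv hvt
        simp [vertices] at hv
        exact absurd hv hvt
      · exact h
    have hk := label_mem_iff_of_sib hn ht hv hvt
    rw [vertexLabel_eq hn2 ht hv hvt, Option.getD_some]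
    generalize fullLabel n t v = k at hk
    have hl := matchings_apply_mem hπ hk
    have hkl := (hπ.2 k).2 hk
    have hlk := hπ.1 k
    rw [Finset.mem_Icc] at hk hl
    have hother : ∀ i, i ≠ k → i ≠ Psi n t k → Psi n t i ≠ k ∧ Psi n t i ≠ Psi n t k :=
      fun i h1 h2 => ⟨fun e => h2 (by rw [← e, hπ.1]), fun e => h1 (hπ.1.injective e)⟩
    generalize Psi n t = π at *
    simp only [Function.update_apply]
    by_cases c1 : i = 2 * n - 1
    · subst c1
      rw [if_pos rfl, Equiv.swap_apply_right, Equiv.swap_apply_of_ne_of_ne (a := 2 * n - 1)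
        (by omega) (by omega), Equiv.swap_apply_of_ne_of_ne hkl (by omega)]
    rw [if_neg c1]
    by_cases c2 : i = π k
    · subst c2
      rw [if_pos rfl, Equiv.swap_apply_of_ne_of_ne hkl c1, Equiv.swap_apply_of_ne_of_ne c1
        (by omega), hlk, Equiv.swap_apply_left]
    rw [if_neg c2]
    by_cases c3 : i = 2 * n
    · subst c3
      rw [if_pos rfl, Equiv.swap_apply_of_ne_of_ne (a := k) (by omega) c1, Equiv.swap_apply_right,
        e1, Equiv.swap_apply_right]
    rw [if_neg c3]
    by_cases c4 : i = k
    · subst c4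
      rw [if_pos rfl, Equiv.swap_apply_left, Equiv.swap_apply_left, e2,
        Equiv.swap_apply_of_ne_of_ne (by omega) (by omega)]
    rw [if_neg c4, Equiv.swap_apply_of_ne_of_ne c4 c1, Equiv.swap_apply_of_ne_of_ne c1 c3,
      Equiv.swap_apply_of_ne_of_ne (hother i c4 c2).1 (hlt i c1 c3).1]

/-- A composition of three bijections: read the label of the mark, apply `Psi` to the tree, add the
pair. -/
theorem bijOn_PsiMarked {n : ℕ} (hn : 1 ≤ n) :
    Set.BijOn (PsiMarked n) (markedTrees n) (matchings (2 * n)) := by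
  have h1 := bijOn_mark hn
  have h2 : Set.BijOn (fun p : ℕ × BTree => (p.1, Psi n p.2))
      ((Finset.Icc 1 (2 * n - 2 + 1) : Finset ℕ) ×ˢ labelledTrees n)
      ((Finset.Icc 1 (2 * n - 2 + 1) : Finset ℕ) ×ˢ matchings (2 * n - 2)) := by
    have hp := bijOn_Psi hn
    refine Set.BijOn.mk ?_ ?_ ?_
    · rintro ⟨c, t⟩ ⟨hc, ht⟩
      exact ⟨hc, hp.mapsTo ht⟩
    · rintro ⟨c, t⟩ ⟨-, ht⟩ ⟨c', t'⟩ ⟨-, ht'⟩ e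
      obtain ⟨rfl, e2⟩ := Prod.mk.inj e
      exact congrArg _ (hp.injOn ht ht' e2)
    · rintro ⟨c, π⟩ ⟨hc, hπ⟩
      obtain ⟨t, ht, rfl⟩ := hp.surjOn hπ
      exact ⟨(c, t), ⟨hc, ht⟩, rfl⟩
  have h3 := ((bijOn_addPair (2 * n - 2)).comp h2).comp h1
  rw [show 2 * n - 2 + 2 = 2 * n by omega] at h3
  exact h3.congr fun m hm => (PsiMarked_eq hn hm).symm

end WellLabelled

/-! ### The compositions and the counts. -/

theorem mainTheorem3 :
    (∀ n : ℕ, 2 ≤ n →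
      Set.MapsTo WellLabelled.Phi (WellLabelled.motzkinPaths n) (WellLabelled.labelledTrees n) ∧
      Set.MapsTo (WellLabelled.Psi n) (WellLabelled.labelledTrees n)
        (WellLabelled.matchings (2 * n - 2)) ∧
      Set.BijOn (WellLabelled.Psi n ∘ WellLabelled.Phi)
        (WellLabelled.motzkinPaths n) (WellLabelled.matchings (2 * n - 2))) ∧
    (∀ n : ℕ, 1 ≤ n →
      Set.MapsTo WellLabelled.PhiMarked (WellLabelled.positivePaths n)
        (WellLabelled.markedTrees n) ∧
      Set.MapsTo (WellLabelled.PsiMarked n) (WellLabelled.markedTrees n)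
        (WellLabelled.matchings (2 * n)) ∧
      Set.BijOn (WellLabelled.PsiMarked n ∘ WellLabelled.PhiMarked)
        (WellLabelled.positivePaths n) (WellLabelled.matchings (2 * n))) ∧
    (∀ n : ℕ, 1 ≤ n →
      (WellLabelled.motzkinPaths (n + 1)).ncard = Nat.doubleFactorial (2 * n - 1) ∧
      (WellLabelled.positivePaths n).ncard = Nat.doubleFactorial (2 * n - 1)) := by
  open WellLabelled in
  have ha : ∀ n : ℕ, 2 ≤ n → Set.BijOn (Psi n ∘ Phi) (motzkinPaths n) (matchings (2 * n - 2)) :=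
    fun n hn => (bijOn_Psi (by omega)).comp (bijOn_Phi hn)
  have hb : ∀ n : ℕ, 1 ≤ n →
      Set.BijOn (PsiMarked n ∘ PhiMarked) (positivePaths n) (matchings (2 * n)) :=
    fun n hn => (bijOn_PsiMarked hn).comp (bijOn_PhiMarked n)
  refine ⟨fun n hn => ⟨(bijOn_Phi hn).mapsTo, (bijOn_Psi (by omega)).mapsTo, ha n hn⟩,
    fun n hn => ⟨(bijOn_PhiMarked n).mapsTo, (bijOn_PsiMarked hn).mapsTo, hb n hn⟩,
    fun n hn => ⟨?_, ?_⟩⟩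
  · rw [← (ha (n + 1) (by omega)).injOn.ncard_image, (ha (n + 1) (by omega)).image_eq,
      show 2 * (n + 1) - 2 = 2 * n by omega, (finite_ncard_matchings n).2]
  · rw [← (hb n hn).injOn.ncard_image, (hb n hn).image_eq, (finite_ncard_matchings n).2]
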